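/- **Setting.** A finite constrained game has a finite nonempty set of agents $I$ with $n=|I|$, finite action sets $A_i$ with $A=\prod_{i\in I} A_i$, utilities $U_i:A\to\mathbb R$, and constraint functions $C_i:A\to 2^{A_i}$ with $a_i\in C_i(a)$ for all $a\in A$. For each noise level $\epsilon\ge 0$, an update policy $\pi_\epsilon$ assigns to every agent $i$ and profile $a$ a probability distribution $\pi_\epsilon(C_i(a);U_i)$ on $C_i(a)$ that depends only on $\epsilon$, $i$, $a_i$, $C_i(a)$ and the values $U_i(a_i',a_{-i})$ for $a_i'\in C_i(a)$. *Asynchronous algorithm, chain $P_\epsilon$ on $A$.* From $a$, pick an agent $i$ uniformly at random, draw $a_i^+\sim\pi_\epsilon(C_i(a);U_i)$, and set $a^+_{-i}=a_{-i}$. *Coupling functions.* For $J\subseteq I\setminus\{i\}$, agent $i$ is uncoupled from $J$ at $a$ if $U_i(a_i',a_J',a_{-iJ})=U_i(a_i',a_J,a_{-iJ})$ and $C_i(a_i',a_J',a_{-iJ})=C_i(a_i',a_J,a_{-iJ})$ for all $a_i'\in C_i(a)$ and $a_J'\in\prod_{j\in J}C_j(a)$. Maps $I_i^c:A\to 2^I$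 ($i\in I$) are valid coupling functions if, for all $i,j\in I$ and $a\in A$: $i\in I_i^c(a)$; $i\in I_j^c(a)\Leftrightarrow j\in I_i^c(a)$; and $i$ is uncoupled from $I\setminus I_i^c(a)$ at $a$. *Synchronous algorithm with inertia $\kappa\in(0,1)$, chain $P'_\epsilon$ on $A$.* From $a$, every agent $i$ independently draws $\kappa_i\sim\mathcal U(0,1)$ and an intended action $\bar a_i\sim\pi_\epsilon(C_i(a);U_i)$. It sets $\beta_i=0$ if $\bar a_i=a_i$ or $\kappa_i\le\kappa$, and otherwise draws $\beta_i\sim\mathcal U(0,1)$ independently. Then $a_i^+=a_i$ if $\beta_i=0$ or there is $j\ne i$ in $I_i^c(a)$ with $\beta_j\ge\beta_i$, and $a_i^+=\bar a_i$ otherwise. *Regular perturbed chains.* A family $(P_\epsilon)_{\epsilon\ge0}$ of transition matrices on a finite set is a regular perturbed Markov chain if $P_\epsilon$ is irreducible and aperiodic for every $\epsilon>0$, $\lim_{\epsilon\to0^+}P_\epsilon=P_0$, and, whenever $P_\epsilon(a,a')>0$ for some $\epsilon>0$, there is $R(a,a')\ge0$ (the resistance of the transition) with $0<\lim_{\epsilon\to0^+}P_\epsilon(a,a')/\epsilon^{R(a,a')}<\infty$.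 The stochastic potential of a state $a$ is the minimum total resistance of a spanning tree rooted at $a$, with edges directed towards $a$, whose edges are feasible transitions. A state $a$ is stochastically stable if $\lim_{\epsilon\to0^+}\mu^*_\epsilon(a)$ exists and is positive, where $\mu^*_\epsilon$ is the limiting distribution of $P_\epsilon$. A state of a finite chain is recurrent if it is reachable from every state reachable from it. **Theorem 1.** Suppose that the chain $P_\epsilon$ induced by the asynchronous algorithm is a regular perturbed Markov chain, that $\{I_i^c\}_{i\in I}$ are valid coupling functions, and that $\kappa\in(0,1)$. Then the chain $P'_\epsilon$ induced by the synchronous algorithm is a regular perturbed Markov chain, and $P_\epsilon$ and $P'_\epsilon$ have the same stochastically stable states. Moreover, every state has the same stochastic potential in both chains, and $P_0$ and $P'_0$ have the same recurrent states. -/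

import Mathlib

open Filter Topology MeasureTheory

/-! ### Finite Markov chains and their perturbations -/

/-- A finite chain is aperiodic if the period of every state, i.e. the greatest common divisor of
its possible return times, equals one. -/
def IsAperiodic {S : Type*} [Fintype S] [DecidableEq S] (M : Matrix S S ℝ) : Prop :=
  ∀ a : S, ∀ d : ℕ, (∀ t : ℕ, 0 < (M ^ t) a a → d ∣ t) → d = 1

/-- `b` is reachable from `a`. -/
def Reachable {S : Type*} [Fintype S] [DecidableEq S] (M : Matrix S S ℝ) (a b : S) : Prop :=
  ∃ t : ℕ, 0 < (M ^ t) a b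

/-- A state of a finite chain is recurrent if it is reachable from every state that is reachable
from it. -/
def IsRecurrentState {S : Type*} [Fintype S] [DecidableEq S] (M : Matrix S S ℝ) (a : S) : Prop :=
  ∀ b : S, Reachable M a b → Reachable M b a

/-- `r` is the resistance of the transition from `a` to `b`: `r ≥ 0` and
`0 < lim_{ε → 0⁺} P_ε(a,b) / ε ^ r < ∞`. -/
def IsResistance {S : Type*} (P : ℝ → Matrix S S ℝ) (a b : S) (r : ℝ) : Prop :=
  0 ≤ r ∧ ∃ L : ℝ, 0 < L ∧ Tendsto (fun ε : ℝ => P ε a b / ε ^ r) (𝓝[>] 0) (𝓝 L)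

/-- Regular perturbed Markov chain `P_ε` (`ε ≥ 0`), with unperturbed chain `P_0`. -/
structure IsRegularPerturbedChain {S : Type*} [Fintype S] [DecidableEq S]
    (P : ℝ → Matrix S S ℝ) : Prop where
  stochastic : ∀ ε : ℝ, 0 ≤ ε → P ε ∈ Matrix.rowStochastic ℝ S
  irreducible : ∀ ε : ℝ, 0 < ε → (P ε).IsIrreducible
  aperiodic : ∀ ε : ℝ, 0 < ε → IsAperiodic (P ε)
  tendsto_zero : ∀ a b : S, Tendsto (fun ε : ℝ => P ε a b) (𝓝[>] 0) (𝓝 (P 0 a b))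
  exists_resistance : ∀ a b : S, ∀ ε : ℝ, 0 < ε → 0 < P ε a b → ∃ r : ℝ, IsResistance P a b r

/-- `μ` is the limiting distribution of the chain with transition matrix `M`, whatever the initial
state. -/
def IsLimitingDistribution {S : Type*} [Fintype S] [DecidableEq S]
    (M : Matrix S S ℝ) (μ : S → ℝ) : Prop :=
  ∀ a b : S, Tendsto (fun t : ℕ => (M ^ t) a b) atTop (𝓝 (μ b))

/-- `a` is stochastically stable: the limiting distributions `μ_ε` of `P_ε`, `ε > 0`, exist, and
`lim_{ε → 0⁺} μ_ε(a)` exists and is positive. -/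
def IsStochasticallyStable {S : Type*} [Fintype S] [DecidableEq S]
    (P : ℝ → Matrix S S ℝ) (a : S) : Prop :=
  ∃ μ : ℝ → S → ℝ, (∀ ε : ℝ, 0 < ε → IsLimitingDistribution (P ε) (μ ε)) ∧
    ∃ L : ℝ, 0 < L ∧ Tendsto (fun ε : ℝ => μ ε a) (𝓝[>] 0) (𝓝 L)

/-- A spanning tree rooted at `root` (all edges directed towards the root), given by the end
`next v` of the unique edge that leaves each `v ≠ root`. -/
def IsSpanningTree {S : Type*} (root : S) (next : S → S) : Prop :=
  next root = root ∧ ∀ v : S, ∃ k : ℕ, next^[k] v = root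

/-- `w` is the total resistance of some spanning tree rooted at `root` whose edges are feasible
transitions of `P_ε`. -/
def IsTreeResistance {S : Type*} [Fintype S] [DecidableEq S]
    (P : ℝ → Matrix S S ℝ) (root : S) (w : ℝ) : Prop :=
  ∃ (next : S → S) (r : S → ℝ), IsSpanningTree root next ∧
    (∀ v : S, v ≠ root → IsResistance P v (next v) (r v)) ∧
    w = ∑ v ∈ Finset.univ.erase root, r v

/-- `γ` is the stochastic potential of `a`: the total resistance of a minimum resistance tree
rooted at `a`. -/
def IsStochasticPotential {S : Type*} [Fintype S] [DecidableEq S]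
    (P : ℝ → Matrix S S ℝ) (a : S) (γ : ℝ) : Prop :=
  IsLeast {w : ℝ | IsTreeResistance P a w} γ

/-! ### Constrained games, update policies, couplings -/

/-- A constrained game with agents `I`, action sets `A i`, utilities `U i` and constraint
functions `C i`. -/
structure ConstrainedGame (I : Type*) (A : I → Type*) where
  U : I → (∀ i, A i) → ℝ
  C : ∀ i : I, (∀ i, A i) → Set (A i)
  self_mem : ∀ (i : I) (a : ∀ i, A i), a i ∈ C i a

/-- An update policy `π_ε`, `ε ≥ 0`. The number `prob ε i x D u y` is the probability that agent
`i`, whose current action is `x`, whose feasible set is `D ∋ x` and whose unilateral deviation to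
`z ∈ D` would give the utility `u z`, chooses the action `y`. -/
structure UpdatePolicy (I : Type*) (A : I → Type*) [∀ i, Fintype (A i)] where
  prob : ℝ → ∀ i : I, A i → Set (A i) → (A i → ℝ) → A i → ℝ
  nonneg : ∀ (ε : ℝ) (i : I) (x : A i) (D : Set (A i)) (u : A i → ℝ) (y : A i),
    0 ≤ ε → x ∈ D → 0 ≤ prob ε i x D u y
  sum_eq_one : ∀ (ε : ℝ) (i : I) (x : A i) (D : Set (A i)) (u : A i → ℝ),
    0 ≤ ε → x ∈ D → ∑ y, prob ε i x D u y = 1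
  eq_zero_of_notMem : ∀ (ε : ℝ) (i : I) (x : A i) (D : Set (A i)) (u : A i → ℝ) (y : A i),
    0 ≤ ε → x ∈ D → y ∉ D → prob ε i x D u y = 0
  congr_utility : ∀ (ε : ℝ) (i : I) (x : A i) (D : Set (A i)) (u v : A i → ℝ),
    0 ≤ ε → x ∈ D → (∀ z ∈ D, u z = v z) → prob ε i x D u = prob ε i x D v

/-- The probability that agent `i` chooses `y` by following `π_ε(C_i(a); U_i)` at the profile `a`. -/
def choiceProb {I : Type*} {A : I → Type*} [DecidableEq I] [∀ i, Fintype (A i)]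
    (Γ : ConstrainedGame I A) (π : UpdatePolicy I A) (ε : ℝ) (a : ∀ i, A i) (i : I) (y : A i) :
    ℝ :=
  π.prob ε i (a i) (Γ.C i a) (fun z => Γ.U i (Function.update a i z)) y

/-- Agent `i` is uncoupled from the agents in `J` at the profile `a`. Here `b` runs through the
profiles `(a_i', a_J', a_{-iJ})` with `a_i' ∈ C_i(a)` and `a_J' ∈ C_J(a)`, and
`Function.update a i (b i)` is `(a_i', a_J, a_{-iJ})`. -/
def IsUncoupled {I : Type*} {A : I → Type*} [DecidableEq I]
    (Γ : ConstrainedGame I A) (a : ∀ i, A i) (i : I) (J : Set I) : Prop :=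
  ∀ b : ∀ i, A i, b i ∈ Γ.C i a → (∀ j ∈ J, b j ∈ Γ.C j a) →
    (∀ j, j ≠ i → j ∉ J → b j = a j) →
    Γ.U i b = Γ.U i (Function.update a i (b i)) ∧
    Γ.C i b = Γ.C i (Function.update a i (b i))

/-- Valid coupling functions `I_i^c`. -/
structure IsValidCoupling {I : Type*} {A : I → Type*} [DecidableEq I]
    (Γ : ConstrainedGame I A) (Ic : I → (∀ i, A i) → Set I) : Prop where
  self_mem : ∀ (i : I) (a : ∀ i, A i), i ∈ Ic i a
  symm : ∀ (i j : I) (a : ∀ i, A i), i ∈ Ic j a ↔ j ∈ Ic i a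
  uncoupled : ∀ (i : I) (a : ∀ i, A i), IsUncoupled Γ a i (Ic i a)ᶜ

/-! ### The two learning algorithms -/

/-- Transition matrix of the asynchronous algorithm: an agent `i` is picked uniformly at random,
it replaces its action by a random `y` drawn from its policy, and the others keep their actions. -/
noncomputable def asyncChain {I : Type*} {A : I → Type*} [Fintype I] [DecidableEq I]
    [∀ i, Fintype (A i)] [∀ i, DecidableEq (A i)]
    (Γ : ConstrainedGame I A) (π : UpdatePolicy I A) (ε : ℝ) :
    Matrix (∀ i, A i) (∀ i, A i) ℝ :=
  fun a a' => ∑ i : I, (Fintype.card I : ℝ)⁻¹ *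
    ∑ y : A i, if Function.update a i y = a' then choiceProb Γ π ε a i y else 0

open Classical in
/-- The priority variables `β_i`, where `k i` and `u i` are the values of the uniform random
variables drawn by agent `i` and `abar` is the profile of intended actions. -/
noncomputable def priority {I : Type*} {A : I → Type*} (κ : ℝ) (a abar : ∀ i, A i)
    (k u : I → ℝ) (i : I) : ℝ :=
  if abar i = a i ∨ k i ≤ κ then 0 else u i

open Classical in
/-- The profile `a⁺` after one round of the synchronous algorithm. -/
noncomputable def syncStep {I : Type*} {A : I → Type*} (Ic : I → (∀ i, A i) → Set I) (κ : ℝ)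
    (a abar : ∀ i, A i) (k u : I → ℝ) : ∀ i, A i :=
  fun i =>
    if priority κ a abar k u i = 0 ∨
        ∃ j, j ≠ i ∧ j ∈ Ic i a ∧ priority κ a abar k u i ≤ priority κ a abar k u j
    then a i else abar i

/-- The law of a family of independent random variables, uniform on `(0, 1)`, one per agent. -/
noncomputable def uniformDraws (I : Type*) [Fintype I] : Measure (I → ℝ) :=
  Measure.pi fun _ => volume.restrict (Set.Ioo (0 : ℝ) 1)

/-- Transition matrix of the synchronous algorithm. The intended actions are drawn from the
policies, independently over the agents and independently of the uniform variables `k` (inertia)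
and `u` (priorities). -/
noncomputable def syncChain {I : Type*} {A : I → Type*} [Fintype I] [DecidableEq I]
    [∀ i, Fintype (A i)]
    (Γ : ConstrainedGame I A) (π : UpdatePolicy I A) (Ic : I → (∀ i, A i) → Set I) (κ : ℝ)
    (ε : ℝ) : Matrix (∀ i, A i) (∀ i, A i) ℝ :=
  fun a a' => ∑ abar : ∀ i, A i, (∏ i, choiceProb Γ π ε a i (abar i)) *
    ((uniformDraws I).prod (uniformDraws I)).real
      {ω | syncStep Ic κ a abar ω.1 ω.2 = a'}

/-! ### Iterates and spanning trees -/

/-! In one synchronous round, two coupled agents cannot both switch, since each would need the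
strictly higher priority. So a feasible synchronous transition from `a` to `b` changes the actions
of pairwise uncoupled agents. Its probability is the product of their individual choice
probabilities times a factor with a positive limit (`syncChain_eq_prod_mul_syncFactor`,
`tendsto_syncFactor`, `syncFactor_pos`). Its resistance is therefore the sum of the resistances of
the unilateral switches.

Uncoupled agents do not see each other's switches (`choiceProb_eq_of_isUncoupledMove`). The same
switches can thus be made one at a time, giving an asynchronous path from `a` to `b` with the same
total resistance. Conversely, a proper asynchronous step is a synchronous one of equal resistance.
At `ε = 0` this already makes reachability, hence recurrence, the same in both chains.

For the potentials, an asynchronous tree is also a synchronous tree. In a synchronous tree, each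
edge is replaced by an asynchronous path, and the union of these paths is pruned to a tree that
costs no more (`exists_spanningTree_le_of_costPath`).

Stochastic stability is then a matter of potentials alone. By the Markov chain tree theorem
(`treeWeight_vecMul`), the limiting distribution is proportional to the tree weights. The weight of
`a` has exact order `ε ^ γ a`, where `γ a` is its potential, so the stable states are the minimizers
of `γ`. -/

/-- Walk along `f` up to the first point where `g` departs from it; from there the hypothesis takes
over. -/
theorem exists_iterate_eq_of_agree {S : Type*} {f g : S → S} {root : S}
    (h : ∀ x, g x ≠ f x → ∃ k, g^[k] x = root) (k : ℕ) (x : S) (hx : f^[k] x = root) :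
    ∃ k, g^[k] x = root := by
  induction k generalizing x with
  | zero => exact ⟨0, hx⟩
  | succ k ih =>
    by_cases hgf : g x = f x
    · obtain ⟨l, hl⟩ := ih (f x) (by simpa using hx)
      exact ⟨l + 1, by simpa [hgf] using hl⟩
    · exact h x hgf

theorem iterate_eq_iterate_of_agree {S : Type*} {f g : S → S} {x : S}
    (h : ∀ j, g (f^[j] x) = f (f^[j] x)) (k : ℕ) : g^[k] x = f^[k] x := by
  induction k with
  | zero => rfl
  | succ k ih => rw [Function.iterate_succ_apply', ih, h, Function.iterate_succ_apply']

theorem exists_iterate_trans {S : Type*} {f : S → S} {x y z : S}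
    (hxy : ∃ k, f^[k] x = y) (hyz : ∃ k, f^[k] y = z) : ∃ k, f^[k] x = z := by
  obtain ⟨k, rfl⟩ := hxy
  obtain ⟨l, rfl⟩ := hyz
  exact ⟨l + k, Function.iterate_add_apply f l k x⟩

/-! ### Positive entries of powers -/

section Powers

variable {S : Type*} [Fintype S] [DecidableEq S]

theorem Matrix.pow_succ_apply_pos_iff {M : Matrix S S ℝ} (hM : ∀ i j, 0 ≤ M i j) (t : ℕ)
    (a b : S) : 0 < (M ^ (t + 1)) a b ↔ ∃ c, 0 < M a c ∧ 0 < (M ^ t) c b := by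
  have hp : ∀ i j, 0 ≤ (M ^ t) i j := Matrix.pow_apply_nonneg hM t
  rw [pow_succ', Matrix.mul_apply,
    Finset.sum_pos_iff_of_nonneg (fun c _ => mul_nonneg (hM _ _) (hp _ _))]
  refine exists_congr fun c => ?_
  constructor
  · rintro ⟨-, h⟩
    exact (pos_and_pos_or_neg_and_neg_of_mul_pos h).resolve_right
      fun h' => absurd h'.1 (hM _ _).not_gt
  · rintro ⟨h1, h2⟩
    exact ⟨Finset.mem_univ _, mul_pos h1 h2⟩

theorem Matrix.pow_add_apply_pos {M : Matrix S S ℝ} (hM : ∀ i j, 0 ≤ M i j) {s t : ℕ}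
    {a b c : S} (h1 : 0 < (M ^ s) a b) (h2 : 0 < (M ^ t) b c) : 0 < (M ^ (s + t)) a c := by
  rw [pow_add, Matrix.mul_apply]
  exact (Finset.sum_pos_iff_of_nonneg fun d _ =>
    mul_nonneg (Matrix.pow_apply_nonneg hM s _ _) (Matrix.pow_apply_nonneg hM t _ _)).2
      ⟨b, Finset.mem_univ _, mul_pos h1 h2⟩

theorem exists_spanningTree_of_isIrreducible {M : Matrix S S ℝ} (hM : M.IsIrreducible)
    (root : S) : ∃ next : S → S, IsSpanningTree root next ∧
      ∀ v, v ≠ root → 0 < M v (next v) := by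
  classical
  have hr : ∀ v, ∃ t, 0 < (M ^ t) v root := fun v =>
    ((Matrix.isIrreducible_iff_exists_pow_pos hM.nonneg).1 hM v root).imp fun _ h => h.2
  -- Moving to a strictly smaller hitting time of the root rules out cycles.
  have hstep : ∀ v, v ≠ root → ∃ w, 0 < M v w ∧ Nat.find (hr w) < Nat.find (hr v) := by
    intro v hv
    have hs := Nat.find_spec (hr v)
    rcases hd : Nat.find (hr v) with _ | t
    · rw [hd] at hs
      simp [hv] at hs
    · rw [hd, Matrix.pow_succ_apply_pos_iff hM.nonneg] at hs
      obtain ⟨w, hw, hwt⟩ := hs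
      exact ⟨w, hw, Nat.lt_succ_of_le (Nat.find_min' _ hwt)⟩
  choose! next hnext hlt using hstep
  refine ⟨Function.update next root root, ⟨by simp, ?_⟩, fun v hv => by simpa [hv] using hnext v hv⟩
  have key : ∀ n v, Nat.find (hr v) = n → ∃ k, (Function.update next root root)^[k] v = root := by
    intro n
    induction n using Nat.strong_induction_on with
    | _ n ih =>
      rintro v rfl
      by_cases hv : v = root
      · exact ⟨0, hv⟩
      · obtain ⟨k, hk⟩ := ih _ (hlt v hv) (next v) rfl
        exact ⟨k + 1, by simpa [hv] using hk⟩
  exact fun v => key _ v rfl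

end Powers

/-! ### The Markov chain tree theorem -/

theorem exists_iterate_update {S : Type*} [DecidableEq S] {f : S → S} {v a : S}
    (h : ∃ k, f^[k] v = a) (b : S) : ∃ k, (Function.update f a b)^[k] v = a := by
  obtain ⟨k, hk⟩ := h
  refine exists_iterate_eq_of_agree (f := f) (fun x hx => ⟨0, ?_⟩) k v hk
  by_contra hxa
  exact hx (Function.update_of_ne hxa _ _)

/-- Closing a tree by an edge from its root to `a` creates a cycle through `a`, on which the root is
the predecessor of `a`. A cycle visits only one predecessor of `a`, so the root can be recovered
from the closed map. -/
theorem root_eq_of_update_eq {S : Type*} [DecidableEq S] {a b b' : S} {f f' : S → S} (hf : IsSpanningTree b f)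
    (hf' : IsSpanningTree b' f') (h : Function.update f b a = Function.update f' b' a) :
    b = b' := by
  have reach : ∀ {c : S} {e : S → S}, IsSpanningTree c e →
      ∃ k, (Function.update e c a)^[k] a = c := by
    intro c e he
    exact exists_iterate_update (he.2 a) a
  have h1 := reach hf
  have h2 := reach hf'
  rw [← h] at h2
  set g := Function.update f b a with hg
  have hb : g b = a := by simp [hg]
  have hb' : g b' = a := by simp [h]
  have aux : ∀ {c c' : S} (hc : ∃ k, g^[k] a = c) (hc' : ∃ k, g^[k] a = c'), g c = a →
      Nat.find hc' ≤ Nat.find hc := by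
    intro c c' hc hc' hgc
    by_contra! hlt
    have hs := Nat.find_spec hc
    have hs' := Nat.find_spec hc'
    obtain ⟨d, hd⟩ := Nat.exists_eq_add_of_lt hlt
    have hcyc : g^[Nat.find hc + 1] a = a := by rw [Function.iterate_succ_apply', hs, hgc]
    rw [show Nat.find hc' = d + (Nat.find hc + 1) by omega, Function.iterate_add_apply,
      hcyc] at hs'
    exact Nat.find_min hc' (by omega) hs'
  have hle := le_antisymm (aux h2 h1 hb') (aux h1 h2 hb)
  rw [← Nat.find_spec h1, hle, Nat.find_spec h2]

section TreeTheorem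

variable {S : Type*} [Fintype S] [DecidableEq S]

open Classical in
/-- The spanning trees rooted at `root`. -/
noncomputable def spanningTrees (root : S) : Finset (S → S) :=
  Finset.univ.filter fun f => IsSpanningTree root f

theorem mem_spanningTrees {root : S} {f : S → S} :
    f ∈ spanningTrees root ↔ IsSpanningTree root f := by
  simp [spanningTrees]

/-- The sum of the weights of the spanning trees rooted at `root`. -/
noncomputable def treeWeight (M : Matrix S S ℝ) (root : S) : ℝ :=
  ∑ f ∈ spanningTrees root, ∏ v ∈ Finset.univ.erase root, M v (f v)

open Classical in
/-- The maps for which every state eventually reaches `a`. -/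
noncomputable def attractingMaps (a : S) : Finset (S → S) :=
  Finset.univ.filter fun g => ∀ v, ∃ k, g^[k] v = a

theorem mem_attractingMaps {a : S} {g : S → S} :
    g ∈ attractingMaps a ↔ ∀ v, ∃ k, g^[k] v = a := by
  simp [attractingMaps]

theorem prod_update_eq (M : Matrix S S ℝ) (f : S → S) (b a : S) :
    ∏ v, M v (Function.update f b a v) = (∏ v ∈ Finset.univ.erase b, M v (f v)) * M b a := by
  rw [← Finset.prod_erase_mul _ _ (Finset.mem_univ b), Function.update_self]
  congr 1
  refine Finset.prod_congr rfl fun v hv => ?_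
  rw [Function.update_of_ne (Finset.ne_of_mem_erase hv)]

/-- A map attracting everything to `a` has a single cycle, which passes through `a`. Cutting the
edge that leaves `a` yields a tree rooted at `a` and a free target for the cut edge. -/
theorem treeWeight_mul_sum (M : Matrix S S ℝ) (a : S) :
    treeWeight M a * ∑ b, M a b = ∑ g ∈ attractingMaps a, ∏ v, M v (g v) := by
  rw [treeWeight, Finset.sum_mul_sum, ← Finset.sum_product']
  refine Finset.sum_bij' (fun x _ => Function.update x.1 a x.2)
    (fun g _ => (Function.update g a a, g a)) ?_ ?_ ?_ ?_ ?_
  · rintro ⟨f, b⟩ h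
    simp only [Finset.mem_product, Finset.mem_univ, and_true, mem_spanningTrees] at h
    rw [mem_attractingMaps]
    exact fun v => exists_iterate_update (h.2 v) b
  · intro g hg
    rw [mem_attractingMaps] at hg
    simp only [Finset.mem_product, Finset.mem_univ, and_true, mem_spanningTrees]
    exact ⟨by simp, fun v => exists_iterate_update (hg v) a⟩
  · rintro ⟨f, b⟩ h
    simp only [Finset.mem_product, Finset.mem_univ, and_true, mem_spanningTrees] at h
    ext1
    · conv_rhs => rw [← Function.update_eq_self a f, h.1]
      simp
    · simp
  · intro g hg
    simp
  · rintro ⟨f, b⟩ h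
    exact (prod_update_eq M f a b).symm

/-- Here the cycle through `a` is cut at the edge that enters `a`, which leaves a tree rooted at the
predecessor of `a`. Counting the same maps in two ways gives the balance equation at `a`. -/
theorem sum_treeWeight_mul (M : Matrix S S ℝ) (a : S) :
    ∑ b, treeWeight M b * M b a = ∑ g ∈ attractingMaps a, ∏ v, M v (g v) := by
  simp only [treeWeight, Finset.sum_mul]
  rw [Finset.sum_sigma']
  refine Finset.sum_bij (fun x _ => Function.update x.2 x.1 a) ?_ ?_ ?_ ?_
  · rintro ⟨b, f⟩ h
    simp only [Finset.mem_sigma, Finset.mem_univ, true_and, mem_spanningTrees] at h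
    rw [mem_attractingMaps]
    exact fun v => exists_iterate_trans (exists_iterate_update (h.2 v) a) ⟨1, by simp⟩
  · rintro ⟨b, f⟩ h ⟨b', f'⟩ h' heq
    simp only [Finset.mem_sigma, Finset.mem_univ, true_and, mem_spanningTrees] at h h'
    obtain rfl := root_eq_of_update_eq h h' heq
    congr 1
    have := congrArg (fun g => Function.update g b b) heq
    simp only [Function.update_idem] at this
    rw [← Function.update_eq_self b f, h.1, this]
    conv_rhs => rw [← Function.update_eq_self b f', h'.1]
  · intro g hg
    rw [mem_attractingMaps] at hg
    obtain ⟨k, hk⟩ := hg (g a)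
    -- The orbit of `a` returns to `a` after `k + 1` steps, so `g^[k] a` is the predecessor of `a`
    -- on the cycle.
    have hb : g (g^[k] a) = a := by
      rw [← Function.iterate_succ_apply' g, Function.iterate_succ_apply, hk]
    refine ⟨⟨g^[k] a, Function.update g (g^[k] a) (g^[k] a)⟩, ?_, ?_⟩
    · simp only [Finset.mem_sigma, Finset.mem_univ, true_and, mem_spanningTrees]
      exact ⟨by simp, fun v =>
        exists_iterate_update (exists_iterate_trans (hg v) ⟨k, rfl⟩) _⟩
    · simp only [Function.update_idem]
      conv_rhs => rw [← Function.update_eq_self (g^[k] a) g, hb]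
  · rintro ⟨b, f⟩ h
    exact (prod_update_eq M f b a).symm

/-- Markov chain tree theorem. -/
theorem treeWeight_vecMul {M : Matrix S S ℝ} (hM : M ∈ Matrix.rowStochastic ℝ S) :
    Matrix.vecMul (treeWeight M) M = treeWeight M := by
  ext a
  simp only [Matrix.vecMul, dotProduct]
  rw [sum_treeWeight_mul, ← treeWeight_mul_sum, Matrix.sum_row_of_mem_rowStochastic hM, mul_one]

theorem treeWeight_pos {M : Matrix S S ℝ} (hM : M.IsIrreducible) (a : S) :
    0 < treeWeight M a := by
  obtain ⟨f, hf, hpos⟩ := exists_spanningTree_of_isIrreducible hM a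
  refine Finset.sum_pos' (fun g _ => Finset.prod_nonneg fun v _ => hM.nonneg _ _)
    ⟨f, mem_spanningTrees.2 hf, Finset.prod_pos fun v hv => hpos v (Finset.ne_of_mem_erase hv)⟩

end TreeTheorem

/-! ### Convergence to the stationary distribution -/

section Convergence

variable {S : Type*} [Fintype S] [DecidableEq S]

/-- The return times to a state form an additive submonoid of `ℕ` with gcd one, so they contain all
large integers. Loops of suitable length then pad every connecting path to a common length. -/
theorem exists_pow_pos_of_isAperiodic {M : Matrix S S ℝ} (hM : M.IsIrreducible)
    (hap : IsAperiodic M) : ∃ N, ∀ a b, 0 < (M ^ N) a b := by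
  have hirr := (Matrix.isIrreducible_iff_exists_pow_pos hM.nonneg).1 hM
  have hev : ∀ a, ∃ n, ∀ m ≥ n, 0 < (M ^ m) a a := by
    intro a
    let T : AddSubmonoid ℕ :=
      { carrier := {t | 0 < (M ^ t) a a}
        zero_mem' := by simp
        add_mem' := fun hs ht => Matrix.pow_add_apply_pos hM.nonneg hs ht }
    have hg : Nat.setGcd (T : Set ℕ) = 1 :=
      hap a _ fun t ht => Nat.setGcd_dvd_of_mem (s := (T : Set ℕ)) ht
    obtain ⟨n, hn⟩ := Nat.exists_mem_closure_of_ge (T : Set ℕ)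
    refine ⟨n, fun m hm => ?_⟩
    have := hn m hm (by simp [hg])
    rwa [AddSubmonoid.closure_eq] at this
  choose n hn using hev
  choose k _ hk using hirr
  refine ⟨∑ a, n a + ∑ a, ∑ b, k a b, fun a b => ?_⟩
  have h1 : n a ≤ ∑ a, n a := Finset.single_le_sum (fun _ _ => Nat.zero_le _) (Finset.mem_univ a)
  have h2 : k a b ≤ ∑ a, ∑ b, k a b :=
    (Finset.single_le_sum (f := fun b => k a b) (fun _ _ => Nat.zero_le _)
      (Finset.mem_univ b)).trans
      (Finset.single_le_sum (f := fun a => ∑ b, k a b) (fun _ _ => Nat.zero_le _)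
        (Finset.mem_univ a))
  have := Matrix.pow_add_apply_pos hM.nonneg
    (hn a (∑ a, n a + ∑ a, ∑ b, k a b - k a b) (by omega)) (hk a b)
  rwa [Nat.sub_add_cancel (by omega)] at this

/-- Doeblin's contraction estimate. -/
theorem norm_mulVec_le_of_minorization [Nonempty S] {K : Matrix S S ℝ}
    (hK : K ∈ Matrix.rowStochastic ℝ S) {ν f : S → ℝ} (hν : ∑ c, ν c = 1) {δ : ℝ}
    (hδ : ∀ a c, δ * ν c ≤ K a c) (hf : ∑ c, ν c * f c = 0) :
    ‖Matrix.mulVec K f‖ ≤ (1 - δ) * ‖f‖ := by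
  rw [pi_norm_le_iff_of_nonempty]
  intro a
  -- Subtracting `δ * ν` from each row changes nothing because `f` has `ν`-mean zero, and it lowers
  -- the row mass to `1 - δ`.
  have h1 : Matrix.mulVec K f a = ∑ c, (K a c - δ * ν c) * f c := by
    simp only [Matrix.mulVec, dotProduct, sub_mul, Finset.sum_sub_distrib, mul_assoc,
      ← Finset.mul_sum, hf]
    ring
  have h2 : ∑ c, (K a c - δ * ν c) = 1 - δ := by
    rw [Finset.sum_sub_distrib, ← Finset.mul_sum, hν, Matrix.sum_row_of_mem_rowStochastic hK,
      mul_one]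
  rw [h1, ← h2, Finset.sum_mul]
  refine (norm_sum_le _ _).trans (Finset.sum_le_sum fun c _ => ?_)
  rw [norm_mul, Real.norm_of_nonneg (sub_nonneg.2 (hδ a c))]
  exact mul_le_mul_of_nonneg_left (norm_le_pi_norm f c) (sub_nonneg.2 (hδ a c))

theorem vecMul_pow_eq_self {M : Matrix S S ℝ} {ν : S → ℝ} (h : Matrix.vecMul ν M = ν) (t : ℕ) :
    Matrix.vecMul ν (M ^ t) = ν := by
  induction t with
  | zero => simp
  | succ t ih => rw [pow_succ, ← Matrix.vecMul_vecMul, ih, h]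

theorem isLimitingDistribution_of_stationary {M : Matrix S S ℝ}
    (hM : M ∈ Matrix.rowStochastic ℝ S) (hirr : M.IsIrreducible) (hap : IsAperiodic M)
    {ν : S → ℝ} (hν0 : ∀ c, 0 ≤ ν c) (hν1 : ∑ c, ν c = 1) (hν : Matrix.vecMul ν M = ν) :
    IsLimitingDistribution M ν := by
  intro a b
  have : Nonempty S := ⟨a⟩
  obtain ⟨N, hN⟩ := exists_pow_pos_of_isAperiodic hirr hap
  obtain ⟨⟨a₀, b₀⟩, hmin⟩ := Finite.exists_min fun x : S × S => (M ^ N) x.1 x.2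
  set δ := (M ^ N) a₀ b₀ with hδ
  have hδ0 : 0 < δ := hN _ _
  have hpow : ∀ t, M ^ t ∈ Matrix.rowStochastic ℝ S := fun t => pow_mem hM t
  have hδ1 : δ ≤ 1 := Matrix.le_one_of_mem_rowStochastic (hpow N)
  have hνle : ∀ c, ν c ≤ 1 := fun c => hν1 ▸
    Finset.single_le_sum (f := ν) (fun c _ => hν0 c) (Finset.mem_univ c)
  have hminor : ∀ x c, δ * ν c ≤ (M ^ N) x c := fun x c =>
    (mul_le_of_le_one_right hδ0.le (hνle c)).trans (hmin (x, c))
  let f : ℕ → S → ℝ := fun t x => (M ^ t) x b - ν b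
  have hf0 : ∀ t, ∑ c, ν c * f t c = 0 := by
    intro t
    have := congrFun (vecMul_pow_eq_self hν t) b
    simp only [Matrix.vecMul, dotProduct] at this
    simp only [f, mul_sub, Finset.sum_sub_distrib, this, ← Finset.sum_mul, hν1]
    ring
  have hfadd : ∀ s t, f (s + t) = Matrix.mulVec (M ^ s) (f t) := by
    intro s t
    ext x
    simp only [f, Matrix.mulVec, dotProduct, mul_sub, Finset.sum_sub_distrib, ← Finset.sum_mul,
      Matrix.sum_row_of_mem_rowStochastic (hpow s), one_mul, pow_add, Matrix.mul_apply]
  have hcontr : ∀ t, ‖f (N + t)‖ ≤ (1 - δ) * ‖f t‖ := fun t => by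
    rw [hfadd]
    exact norm_mulVec_le_of_minorization (hpow N) hν1 hminor (hf0 t)
  -- The estimate with `δ = 0` is nonexpansiveness; it controls the times between multiples of `N`.
  have hanti : Antitone fun t => ‖f t‖ := by
    refine antitone_nat_of_succ_le fun t => ?_
    rw [add_comm, hfadd]
    have := norm_mulVec_le_of_minorization (hpow 1) hν1 (δ := 0)
      (fun a c => by simpa using Matrix.nonneg_of_mem_rowStochastic hM) (hf0 t)
    simpa using this
  have hgeom : ∀ k, ‖f (k * N)‖ ≤ (1 - δ) ^ k * ‖f 0‖ := by
    intro k
    induction k with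
    | zero => simp
    | succ k ih =>
      rw [Nat.succ_mul, add_comm, pow_succ', mul_assoc]
      exact (hcontr _).trans (mul_le_mul_of_nonneg_left ih (by linarith))
  have hlim : Tendsto (fun k : ℕ => (1 - δ) ^ k * ‖f 0‖) atTop (𝓝 0) := by
    simpa using (tendsto_pow_atTop_nhds_zero_of_lt_one (by linarith : 0 ≤ 1 - δ)
      (by linarith)).mul_const ‖f 0‖
  have hnorm : Tendsto (fun t => ‖f t‖) atTop (𝓝 0) := by
    rw [Metric.tendsto_atTop]
    intro e he
    obtain ⟨k, hk⟩ := (hlim.eventually (gt_mem_nhds he)).exists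
    refine ⟨k * N, fun t ht => ?_⟩
    rw [Real.dist_0_eq_abs, abs_of_nonneg (norm_nonneg _)]
    exact ((hanti ht).trans (hgeom k)).trans_lt hk
  have hfa := (tendsto_pi_nhds.1 (tendsto_zero_iff_norm_tendsto_zero.2 hnorm)) a
  simpa [f] using hfa.add_const (ν b)

theorem IsLimitingDistribution.unique {M : Matrix S S ℝ} {μ ν : S → ℝ}
    (hμ : IsLimitingDistribution M μ) (hν : IsLimitingDistribution M ν) : μ = ν :=
  funext fun b => tendsto_nhds_unique (hμ b b) (hν b b)

theorem isLimitingDistribution_treeWeight {M : Matrix S S ℝ}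
    (hM : M ∈ Matrix.rowStochastic ℝ S) (hirr : M.IsIrreducible) (hap : IsAperiodic M) :
    IsLimitingDistribution M fun a => treeWeight M a / ∑ b, treeWeight M b := by
  intro a
  have : Nonempty S := ⟨a⟩
  have hpos : 0 < ∑ b, treeWeight M b :=
    Finset.sum_pos (fun b _ => treeWeight_pos hirr b) Finset.univ_nonempty
  refine isLimitingDistribution_of_stationary hM hirr hap
    (fun c => div_nonneg (treeWeight_pos hirr c).le hpos.le) ?_ ?_ a
  · rw [← Finset.sum_div, div_self hpos.ne']
  · ext c
    have := congrFun (treeWeight_vecMul hM) c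
    simp only [Matrix.vecMul, dotProduct] at this ⊢
    simp only [div_mul_eq_mul_div, ← Finset.sum_div, this]

end Convergence

/-! ### Orders of magnitude and resistances -/

/-- `p ε` is of the exact order `ε ^ r` as `ε → 0⁺`. -/
def HasOrder (p : ℝ → ℝ) (r : ℝ) : Prop :=
  0 ≤ r ∧ ∃ L : ℝ, 0 < L ∧ Tendsto (fun ε : ℝ => p ε / ε ^ r) (𝓝[>] 0) (𝓝 L)

theorem eventually_pos_nhdsGT : ∀ᶠ ε : ℝ in 𝓝[>] 0, 0 < ε := self_mem_nhdsWithin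

theorem tendsto_rpow_nhdsGT_zero {s : ℝ} (hs : 0 < s) :
    Tendsto (fun ε : ℝ => ε ^ s) (𝓝[>] 0) (𝓝 0) := by
  have := (Real.continuousAt_rpow_const 0 s (Or.inr hs.le)).tendsto
  rw [Real.zero_rpow hs.ne'] at this
  exact this.mono_left nhdsWithin_le_nhds

theorem tendsto_div_rpow_of_lt {p : ℝ → ℝ} {r s L : ℝ} (hrs : r < s)
    (h : Tendsto (fun ε : ℝ => p ε / ε ^ s) (𝓝[>] 0) (𝓝 L)) :
    Tendsto (fun ε : ℝ => p ε / ε ^ r) (𝓝[>] 0) (𝓝 0) := by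
  have := h.mul (tendsto_rpow_nhdsGT_zero (sub_pos.2 hrs))
  rw [mul_zero] at this
  refine this.congr' ?_
  filter_upwards [eventually_pos_nhdsGT] with ε hε
  rw [Real.rpow_sub hε]
  have := (Real.rpow_pos_of_pos hε s).ne'
  field_simp

theorem HasOrder.unique {p : ℝ → ℝ} {r s : ℝ} (hr : HasOrder p r) (hs : HasOrder p s) :
    r = s := by
  obtain ⟨-, L, hL, hrL⟩ := hr
  obtain ⟨-, K, hK, hsK⟩ := hs
  rcases lt_trichotomy r s with h | h | h
  · exact absurd (tendsto_nhds_unique hrL (tendsto_div_rpow_of_lt h hsK)) hL.ne'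
  · exact h
  · exact absurd (tendsto_nhds_unique hsK (tendsto_div_rpow_of_lt h hrL)) hK.ne'

theorem HasOrder.exists_pos {p : ℝ → ℝ} {r : ℝ} (h : HasOrder p r) : ∃ ε, 0 < ε ∧ 0 < p ε := by
  obtain ⟨-, L, hL, hrL⟩ := h
  obtain ⟨ε, hε, h0⟩ := ((hrL.eventually (lt_mem_nhds hL)).and eventually_pos_nhdsGT).exists
  exact ⟨ε, h0, (div_pos_iff_of_pos_right (Real.rpow_pos_of_pos h0 r)).1 hε⟩

theorem tendsto_prod_div_rpow {ι : Type*} (s : Finset ι) {p : ι → ℝ → ℝ} {r L : ι → ℝ}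
    (h : ∀ i ∈ s, Tendsto (fun ε : ℝ => p i ε / ε ^ r i) (𝓝[>] 0) (𝓝 (L i))) :
    Tendsto (fun ε : ℝ => (∏ i ∈ s, p i ε) / ε ^ ∑ i ∈ s, r i) (𝓝[>] 0) (𝓝 (∏ i ∈ s, L i)) := by
  refine (tendsto_finsetProd s h).congr' ?_
  filter_upwards [eventually_pos_nhdsGT] with ε hε
  rw [Finset.prod_div_distrib, Real.rpow_sum_of_pos hε]

theorem HasOrder.prod {ι : Type*} (s : Finset ι) {p : ι → ℝ → ℝ} {r : ι → ℝ}
    (h : ∀ i ∈ s, HasOrder (p i) (r i)) :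
    HasOrder (fun ε => ∏ i ∈ s, p i ε) (∑ i ∈ s, r i) := by
  have hL : ∀ i ∈ s, ∃ L : ℝ, 0 < L ∧
      Tendsto (fun ε : ℝ => p i ε / ε ^ r i) (𝓝[>] 0) (𝓝 L) := fun i hi => (h i hi).2
  choose! L hL0 hL using hL
  exact ⟨Finset.sum_nonneg fun i hi => (h i hi).1, _, Finset.prod_pos hL0,
    tendsto_prod_div_rpow s hL⟩

theorem HasOrder.mul_tendsto {p g : ℝ → ℝ} {r L : ℝ} (h : HasOrder p r) (hL : 0 < L)
    (hg : Tendsto g (𝓝[>] 0) (𝓝 L)) : HasOrder (fun ε => p ε * g ε) r := by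
  obtain ⟨h0, K, hK, hpK⟩ := h
  refine ⟨h0, K * L, mul_pos hK hL, (hpK.mul hg).congr fun ε => ?_⟩
  ring

theorem IsResistance.hasOrder {S : Type*} {P : ℝ → Matrix S S ℝ} {a b : S} {r : ℝ}
    (h : IsResistance P a b r) : HasOrder (fun ε => P ε a b) r := h

theorem HasOrder.isResistance {S : Type*} {P : ℝ → Matrix S S ℝ} {a b : S} {r : ℝ}
    (h : HasOrder (fun ε => P ε a b) r) : IsResistance P a b r := h

/-! ### Stochastic potential and stochastic stability -/

section Potential

variable {S : Type*} [Fintype S] [DecidableEq S]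

theorem IsRegularPerturbedChain.exists_isStochasticPotential {P : ℝ → Matrix S S ℝ}
    (hP : IsRegularPerturbedChain P) (a : S) : ∃ γ, IsStochasticPotential P a γ := by
  classical
  have hfin : {w | IsTreeResistance P a w}.Finite := by
    -- Resistances are unique, so a tree determines its total resistance, and there are finitely
    -- many trees.
    refine (Set.finite_range fun next : S → S => ∑ v ∈ Finset.univ.erase a,
      if h : ∃ r, IsResistance P v (next v) r then h.choose else 0).subset ?_
    rintro w ⟨next, r, -, hr, rfl⟩
    refine ⟨next, Finset.sum_congr rfl fun v hv => ?_⟩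
    have h := hr v (Finset.ne_of_mem_erase hv)
    have hex : ∃ r, IsResistance P v (next v) r := ⟨_, h⟩
    simp only [dif_pos hex]
    exact hex.choose_spec.hasOrder.unique h.hasOrder
  have hne : {w | IsTreeResistance P a w}.Nonempty := by
    obtain ⟨next, hn, hpos⟩ := exists_spanningTree_of_isIrreducible (hP.irreducible 1 one_pos) a
    have hr : ∀ v, v ≠ a → ∃ r, IsResistance P v (next v) r := fun v hv =>
      hP.exists_resistance v (next v) 1 one_pos (hpos v hv)
    choose! r hr using hr
    exact ⟨_, next, r, hn, hr, rfl⟩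
  obtain ⟨γ, hγ, hmin⟩ := Set.exists_min_image _ id hfin hne
  exact ⟨γ, hγ, hmin⟩

/-- The product along a feasible tree has the order given by its total resistance. After division by
`ε ^ γ` only minimal trees survive, and their limits are positive, so nothing cancels. -/
theorem IsRegularPerturbedChain.tendsto_treeWeight_div {P : ℝ → Matrix S S ℝ}
    (hP : IsRegularPerturbedChain P) {a : S} {γ : ℝ} (hγ : IsStochasticPotential P a γ) :
    ∃ L, 0 < L ∧ Tendsto (fun ε => treeWeight (P ε) a / ε ^ γ) (𝓝[>] 0) (𝓝 L) := by
  have hdiv : ∀ (f : S → S) (r : S → ℝ), IsSpanningTree a f →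
      (∀ v, v ≠ a → IsResistance P v (f v) (r v)) →
      ∃ L, 0 ≤ L ∧ (∑ v ∈ Finset.univ.erase a, r v = γ → 0 < L) ∧ Tendsto
        (fun ε => (∏ v ∈ Finset.univ.erase a, P ε v (f v)) / ε ^ γ) (𝓝[>] 0) (𝓝 L) := by
    intro f r hf hr
    obtain ⟨-, L, hL, hlim⟩ := HasOrder.prod (Finset.univ.erase a)
      fun v hv => (hr v (Finset.ne_of_mem_erase hv)).hasOrder
    have hle : γ ≤ ∑ v ∈ Finset.univ.erase a, r v := hγ.2 ⟨f, r, hf, hr, rfl⟩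
    rcases hle.lt_or_eq with hlt | heq
    · exact ⟨0, le_rfl, fun h => absurd h hlt.ne', tendsto_div_rpow_of_lt hlt hlim⟩
    · rw [← heq] at hlim
      exact ⟨L, hL.le, fun _ => hL, hlim⟩
  have hall : ∀ f ∈ spanningTrees a, ∃ L, 0 ≤ L ∧ Tendsto
      (fun ε => (∏ v ∈ Finset.univ.erase a, P ε v (f v)) / ε ^ γ) (𝓝[>] 0) (𝓝 L) := by
    intro f hf
    rw [mem_spanningTrees] at hf
    by_cases hfeas : ∀ v, v ≠ a → ∃ ε, 0 < ε ∧ 0 < P ε v (f v)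
    · have hr : ∀ v, v ≠ a → ∃ r, IsResistance P v (f v) r := fun v hv =>
        let ⟨ε, hε, h⟩ := hfeas v hv
        hP.exists_resistance v (f v) ε hε h
      choose! r hr using hr
      obtain ⟨L, hL, -, hlim⟩ := hdiv f r hf hr
      exact ⟨L, hL, hlim⟩
    -- A tree with an infeasible edge has weight zero for every `ε > 0`.
    · push Not at hfeas
      obtain ⟨v, hv, hzero⟩ := hfeas
      refine ⟨0, le_rfl, tendsto_const_nhds.congr' ?_⟩
      filter_upwards [eventually_pos_nhdsGT] with ε hε
      rw [Finset.prod_eq_zero (Finset.mem_erase.2 ⟨hv, Finset.mem_univ v⟩), zero_div]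
      exact le_antisymm (hzero ε hε) ((hP.irreducible ε hε).nonneg _ _)
  choose! L hL hlim using hall
  refine ⟨∑ f ∈ spanningTrees a, L f, ?_, ?_⟩
  · obtain ⟨f, r, hf, hr, hw⟩ := hγ.1
    have hmem := mem_spanningTrees.2 hf
    obtain ⟨K, -, hK, hKlim⟩ := hdiv f r hf hr
    refine Finset.sum_pos' hL ⟨f, hmem, ?_⟩
    rw [tendsto_nhds_unique (hlim f hmem) hKlim]
    exact hK hw.symm
  · simp only [treeWeight, Finset.sum_div]
    exact tendsto_finsetSum _ hlim

/-- Normalize all tree weights by `ε ^ γ c`, with `γ c` the least potential: the limit is positive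
exactly at the minimizers of `γ`. -/
theorem IsRegularPerturbedChain.isStochasticallyStable_iff {P : ℝ → Matrix S S ℝ}
    (hP : IsRegularPerturbedChain P) {γ : S → ℝ} (hγ : ∀ a, IsStochasticPotential P a (γ a))
    (a : S) : IsStochasticallyStable P a ↔ ∀ b, γ a ≤ γ b := by
  have : Nonempty S := ⟨a⟩
  obtain ⟨c, hc⟩ := Finite.exists_min γ
  have hK : ∀ b, ∃ K, 0 ≤ K ∧ (0 < K ↔ γ b = γ c) ∧
      Tendsto (fun ε => treeWeight (P ε) b / ε ^ γ c) (𝓝[>] 0) (𝓝 K) := by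
    intro b
    obtain ⟨L, hL, hlim⟩ := hP.tendsto_treeWeight_div (hγ b)
    rcases (hc b).lt_or_eq with hlt | heq
    · exact ⟨0, le_rfl, by simp [hlt.ne'], tendsto_div_rpow_of_lt hlt hlim⟩
    · rw [heq]
      exact ⟨L, hL.le, by simp [hL], hlim⟩
  choose K hK0 hKpos hK using hK
  have hsum : 0 < ∑ b, K b :=
    Finset.sum_pos' (fun b _ => hK0 b) ⟨c, Finset.mem_univ c, (hKpos c).2 rfl⟩
  have hlim : Tendsto (fun ε => treeWeight (P ε) a / ∑ b, treeWeight (P ε) b) (𝓝[>] 0)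
      (𝓝 (K a / ∑ b, K b)) := by
    refine ((hK a).div (tendsto_finsetSum _ fun b _ => hK b) hsum.ne').congr' ?_
    filter_upwards [eventually_pos_nhdsGT] with ε hε
    rw [Pi.div_apply, ← Finset.sum_div, div_div_div_cancel_right₀ (Real.rpow_pos_of_pos hε _).ne']
  have hdist : ∀ ε : ℝ, 0 < ε → IsLimitingDistribution (P ε)
      fun a => treeWeight (P ε) a / ∑ b, treeWeight (P ε) b := fun ε hε =>
    isLimitingDistribution_treeWeight (hP.stochastic ε hε.le) (hP.irreducible ε hε)
      (hP.aperiodic ε hε)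
  have hmin : (∀ b, γ a ≤ γ b) ↔ γ a = γ c :=
    ⟨fun h => le_antisymm (h c) (hc a), fun h b => h ▸ hc b⟩
  rw [hmin, ← hKpos]
  constructor
  · rintro ⟨μ, hμ, L, hL, hμL⟩
    have hμlim : Tendsto (fun ε => μ ε a) (𝓝[>] 0) (𝓝 (K a / ∑ b, K b)) := by
      refine hlim.congr' ?_
      filter_upwards [eventually_pos_nhdsGT] with ε hε
      exact congrFun ((hdist ε hε).unique (hμ ε hε)) a
    rw [tendsto_nhds_unique hμL hμlim] at hL
    exact (div_pos_iff_of_pos_right hsum).1 hL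
  · exact fun h => ⟨_, hdist, _, div_pos h hsum, hlim⟩

end Potential

/-! ### Rerouting spanning trees -/

section Rerouting

variable {S : Type*}

/-- `CostPath R n a b c`: there is a path of `n` proper steps from `a` to `b`, of total cost `c`,
where `R x y r` says that the step from `x` to `y` costs `r`. -/
inductive CostPath (R : S → S → ℝ → Prop) : ℕ → S → S → ℝ → Prop
  | nil (a : S) : CostPath R 0 a a 0
  | cons {n : ℕ} {a b d : S} {r c : ℝ} (hab : a ≠ b) (h : R a b r) (hp : CostPath R n b d c) :
      CostPath R (n + 1) a d (r + c)

theorem CostPath.nonneg {R : S → S → ℝ → Prop} (hR : ∀ a b r, R a b r → 0 ≤ r) {n : ℕ} {a b : S}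
    {c : ℝ} (h : CostPath R n a b c) : 0 ≤ c := by
  induction h with
  | nil => rfl
  | cons _ h _ ih => exact add_nonneg (hR _ _ _ h) ih

theorem IsSpanningTree.next_not_iterate {root : S} {next : S → S} (h : IsSpanningTree root next)
    {v : S} (hv : v ≠ root) (k : ℕ) : next^[k] (next v) ≠ v := by
  intro hk
  have hper : Function.IsPeriodicPt next (k + 1) v := hk
  obtain ⟨l, hl⟩ := h.2 v
  have hroot : ∀ m, next^[m] root = root := fun m => Function.iterate_fixed h.1 m
  have h1 := hper.const_mul (l + 1)
  rw [Function.IsPeriodicPt, Function.IsFixedPt,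
    show (l + 1) * (k + 1) = (k + l * k + 1) + l by ring, Function.iterate_add_apply, hl,
    hroot] at h1
  exact hv h1.symm

variable [DecidableEq S]

theorem Finset.sum_update_add {ι M : Type*} [DecidableEq ι] [AddCommMonoid M] {s : Finset ι}
    {i : ι} (hi : i ∈ s) (f : ι → M) (x : M) :
    ∑ j ∈ s, Function.update f i x j + f i = ∑ j ∈ s, f j + x := by
  rw [Finset.sum_update_of_mem hi, ← Finset.add_sum_erase s f hi,
    Finset.sdiff_singleton_eq_erase]
  abel

theorem IsSpanningTree.update_of_not_descendant {root : S} {next : S → S}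
    (h : IsSpanningTree root next) {v w : S} (hv : v ≠ root) (hw : ∀ k, next^[k] w ≠ v) :
    IsSpanningTree root (Function.update next v w) := by
  refine ⟨by rw [Function.update_of_ne hv.symm, h.1], fun x => ?_⟩
  obtain ⟨k, hk⟩ := h.2 x
  refine exists_iterate_eq_of_agree (f := next) (fun y hy => ?_) k x hk
  have hyv : y = v := by
    by_contra hyv
    exact hy (Function.update_of_ne hyv _ _)
  obtain ⟨l, hl⟩ := h.2 w
  refine ⟨l + 1, ?_⟩
  rw [Function.iterate_succ_apply, hyv, Function.update_self, ← hl]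
  exact iterate_eq_iterate_of_agree (fun j => Function.update_of_ne (hw j) _ _) l

theorem IsSpanningTree.update_of_descendant {root : S} {next : S → S}
    (h : IsSpanningTree root next) {v w : S} (hv : v ≠ root) (hvw : v ≠ w)
    (hw : ∃ k, next^[k] w = v) :
    IsSpanningTree root (Function.update (Function.update next v w) w (next v)) := by
  have hwr : w ≠ root := by
    rintro rfl
    obtain ⟨k, hk⟩ := hw
    exact hv (hk.symm.trans (Function.iterate_fixed h.1 k))
  have hoff : ∀ y, y ≠ v → y ≠ w →
      Function.update (Function.update next v w) w (next v) y = next y := fun y h1 h2 => by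
    rw [Function.update_of_ne h2, Function.update_of_ne h1]
  refine ⟨by rw [hoff _ hv.symm hwr.symm, h.1], fun x => ?_⟩
  obtain ⟨k, hk⟩ := h.2 x
  -- The old route from `next v` to the root avoids `v`, and it avoids `w` too, since `w` leads back
  -- to `v`.
  have hv_reach : ∃ l, (Function.update (Function.update next v w) w (next v))^[l] (next v) =
      root := by
    obtain ⟨l, hl⟩ := h.2 (next v)
    refine ⟨l, ?_⟩
    rw [← hl]
    refine iterate_eq_iterate_of_agree (fun j => hoff _ (h.next_not_iterate hv j) fun hj => ?_) l
    obtain ⟨m, hm⟩ := hw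
    rw [← hj, ← Function.iterate_add_apply] at hm
    exact h.next_not_iterate hv _ hm
  refine exists_iterate_eq_of_agree (f := next) (fun y hy => ?_) k x hk
  by_cases hyw : y = w
  · exact exists_iterate_trans ⟨1, by simp [hyw]⟩ hv_reach
  · have hyv : y = v := by
      by_contra hyv
      exact hy (hoff y hyv hyw)
    exact exists_iterate_trans ⟨2, by simp [hyv, hvw]⟩ hv_reach

/-- A spanning tree whose edges are replaced by paths contains a spanning tree which is not more
costly. -/
theorem exists_spanningTree_le_of_costPath [Fintype S] {R : S → S → ℝ → Prop}
    (hR : ∀ a b r, R a b r → 0 ≤ r) {root : S} {next : S → S} {len : S → ℕ} {r : S → ℝ}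
    (hT : IsSpanningTree root next)
    (hpath : ∀ v, v ≠ root → CostPath R (len v) v (next v) (r v)) :
    ∃ (next' : S → S) (r' : S → ℝ), IsSpanningTree root next' ∧
      (∀ v, v ≠ root → R v (next' v) (r' v)) ∧
      ∑ v ∈ Finset.univ.erase root, r' v ≤ ∑ v ∈ Finset.univ.erase root, r v := by
  -- Induction on the total number of steps in all paths; when every path has one step, the tree is
  -- as wanted.
  obtain ⟨N, hN⟩ : ∃ N, N = ∑ v ∈ Finset.univ.erase root, len v := ⟨_, rfl⟩
  induction N using Nat.strong_induction_on generalizing next len r with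
  | _ N ih =>
    by_cases hone : ∀ v, v ≠ root → len v = 1
    · refine ⟨next, r, hT, fun v hv => ?_, le_rfl⟩
      have h := hpath v hv
      rw [hone v hv] at h
      generalize next v = u at h
      generalize r v = c at h
      cases h with
      | cons hab h hp =>
        cases hp
        simpa using h
    · push Not at hone
      obtain ⟨v, hv, hmv⟩ := hone
      have hvmem : v ∈ Finset.univ.erase root := Finset.mem_erase.2 ⟨hv, Finset.mem_univ v⟩
      have h := hpath v hv
      obtain ⟨w, k, r₁, c, hvw, hstep, hrest, hmk, hrc⟩ : ∃ w k r₁ c, v ≠ w ∧ R v w r₁ ∧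
          CostPath R (k + 1) w (next v) c ∧ len v = k + 2 ∧ r v = r₁ + c := by
        generalize hu : next v = u at h
        generalize hc : r v = c at h
        generalize hn : len v = n at h hmv
        cases h with
        | nil => exact absurd hu (hT.next_not_iterate hv 0)
        | cons hab h hp =>
          cases hp with
          | nil => exact absurd rfl hmv
          | cons hbd h' hp' => exact ⟨_, _, _, _, hab, h, .cons hbd h' hp', rfl, rfl⟩
      have hc0 := hrest.nonneg hR
      have hsingle : CostPath R 1 v w r₁ := by
        simpa using CostPath.cons hvw hstep (.nil w)
      have hm1 := Finset.sum_update_add hvmem len 1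
      have hr1 := Finset.sum_update_add hvmem r r₁
      -- Let `w` be the first stop on a path from `v` with at least two steps. If the tree route
      -- from `w` passes through `v`, then `w` inherits the rest of the path and its own nonempty
      -- path is dropped. Otherwise `v` is hooked directly to `w` and the rest is dropped. Either
      -- way the total length falls and the cost does not rise.
      by_cases hw : ∃ j, next^[j] w = v
      · have hwr : w ≠ root := by
          rintro rfl
          obtain ⟨j, hj⟩ := hw
          exact hv (hj.symm.trans (Function.iterate_fixed hT.1 j))
        have hwmem : w ∈ Finset.univ.erase root := Finset.mem_erase.2 ⟨hwr, Finset.mem_univ w⟩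
        have hm2 := Finset.sum_update_add hwmem (Function.update len v 1) (k + 1)
        have hr2 := Finset.sum_update_add hwmem (Function.update r v r₁) c
        rw [Function.update_of_ne hvw.symm] at hm2 hr2
        have hmw : len w ≠ 0 := by
          intro h0
          have h := hpath w hwr
          rw [h0] at h
          generalize hu : next w = u at h
          generalize r w = c at h
          cases h
          exact hT.next_not_iterate hwr 0 hu
        have hrw := (hpath w hwr).nonneg hR
        obtain ⟨next', r', h1, h2, h3⟩ := ih _ (by omega)
          (hT.update_of_descendant hv hvw hw)
          (len := Function.update (Function.update len v 1) w (k + 1))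
          (r := Function.update (Function.update r v r₁) w c) (fun x hx => by
            by_cases hxw : x = w
            · subst hxw
              simpa using hrest
            · by_cases hxv : x = v
              · subst hxv
                simpa [hvw] using hsingle
              · simpa [hxw, hxv] using hpath x hx) rfl
        exact ⟨next', r', h1, h2, by linarith⟩
      · push Not at hw
        obtain ⟨next', r', h1, h2, h3⟩ := ih _ (by omega)
          (hT.update_of_not_descendant hv hw)
          (len := Function.update len v 1) (r := Function.update r v r₁) (fun x hx => by
            by_cases hxv : x = v
            · subst hxv
              simpa using hsingle
            · simpa [hxv] using hpath x hx) rfl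
        exact ⟨next', r', h1, h2, by linarith⟩

end Rerouting

/-- If the proper transitions of `P` are transitions of `Q` with the same resistance and every
transition of `Q` can be decomposed into proper transitions of `P` with the same total resistance,
then `P` and `Q` have the same stochastic potentials. -/
theorem IsStochasticPotential.of_costPath {S : Type*} [Fintype S] [DecidableEq S]
    {P Q : ℝ → Matrix S S ℝ}
    (hPQ : ∀ a b r, a ≠ b → IsResistance P a b r → IsResistance Q a b r)
    (hQP : ∀ a b r, IsResistance Q a b r → ∃ n, CostPath (IsResistance P) n a b r)
    {a : S} {γ : ℝ} (h : IsStochasticPotential P a γ) : IsStochasticPotential Q a γ := by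
  constructor
  · obtain ⟨next, r, hT, hr, hw⟩ := h.1
    exact ⟨next, r, hT, fun v hv =>
      hPQ _ _ _ (fun heq => hT.next_not_iterate hv 0 heq.symm) (hr v hv), hw⟩
  · rintro w ⟨next, r, hT, hr, rfl⟩
    have hm : ∀ v, v ≠ a → ∃ n, CostPath (IsResistance P) n v (next v) (r v) := fun v hv =>
      hQP _ _ _ (hr v hv)
    choose! m hm using hm
    obtain ⟨next', r', hT', hr', hle⟩ :=
      exists_spanningTree_le_of_costPath (fun _ _ _ h => h.1) hT hm
    exact (h.2 ⟨next', r', hT', hr', rfl⟩).trans hle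

/-! ### Paths between profiles -/

section Interpolation

variable {I : Type*} {A : I → Type*} [Fintype I] [DecidableEq I] [∀ i, DecidableEq (A i)]

/-- If the agents who play differently at `a` and at `b` can switch one at a time in any order, at
the costs `r i`, then there is a path from `a` to `b` of cost `∑ r i`. -/
theorem exists_costPath_of_interpolation {R : (∀ i, A i) → (∀ i, A i) → ℝ → Prop}
    {a b : ∀ i, A i} {r : I → ℝ}
    (hstep : ∀ (x : ∀ i, A i) (i : I), (∀ j, x j = a j ∨ x j = b j) → b i ≠ x i →
      R x (Function.update x i (b i)) (r i)) :
    ∃ n, CostPath R n a b (∑ i with b i ≠ a i, r i) := by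
  -- Induction on the number of agents that still have to switch.
  have key : ∀ (n : ℕ) (x : ∀ i, A i), (∀ j, x j = a j ∨ x j = b j) →
      (Finset.univ.filter fun i => b i ≠ x i).card = n →
      CostPath R n x b (∑ i with b i ≠ x i, r i) := by
    intro n
    induction n with
    | zero =>
      intro x _ hcard
      rw [Finset.card_eq_zero] at hcard
      have hxb : x = b := by
        ext i
        by_contra h
        have : i ∈ Finset.univ.filter fun i => b i ≠ x i := by simpa using fun h' => h h'.symm
        simp [hcard] at this
      rw [hcard, Finset.sum_empty, hxb]
      exact .nil b
    | succ n ih =>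
      intro x hx hcard
      obtain ⟨i, hi⟩ : (Finset.univ.filter fun i => b i ≠ x i).Nonempty := by
        rw [← Finset.card_pos]; omega
      have hbi : b i ≠ x i := by simpa using hi
      have herase : (Finset.univ.filter fun j => b j ≠ Function.update x i (b i) j) =
          (Finset.univ.filter fun j => b j ≠ x j).erase i := by
        ext j
        by_cases hj : j = i
        · subst hj; simp
        · simp [hj]
      have hpath := ih (Function.update x i (b i)) (fun j => by
        by_cases hj : j = i
        · subst hj; simp
        · simpa [hj] using hx j) (by rw [herase, Finset.card_erase_of_mem hi]; omega)
      rw [herase] at hpath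
      rw [← Finset.add_sum_erase _ r hi]
      refine .cons (fun h => hbi ?_) (hstep x i hx hbi) hpath
      have := congrFun h i
      simpa using this.symm
  exact ⟨_, key _ a (fun j => Or.inl rfl) rfl⟩

end Interpolation

/-! ### The asynchronous chain -/

section Async

variable {I : Type*} {A : I → Type*} [DecidableEq I] [∀ i, Fintype (A i)]
  (Γ : ConstrainedGame I A) (π : UpdatePolicy I A)

theorem choiceProb_nonneg {ε : ℝ} (hε : 0 ≤ ε) (a : ∀ i, A i) (i : I) (y : A i) :
    0 ≤ choiceProb Γ π ε a i y :=
  π.nonneg _ _ _ _ _ _ hε (Γ.self_mem i a)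

theorem sum_choiceProb {ε : ℝ} (hε : 0 ≤ ε) (a : ∀ i, A i) (i : I) :
    ∑ y, choiceProb Γ π ε a i y = 1 :=
  π.sum_eq_one _ _ _ _ _ hε (Γ.self_mem i a)

variable {Γ π} in
theorem mem_constraint_of_choiceProb_pos {ε : ℝ} (hε : 0 ≤ ε) {a : ∀ i, A i} {i : I} {y : A i}
    (h : 0 < choiceProb Γ π ε a i y) : y ∈ Γ.C i a := by
  by_contra hy
  exact h.ne' (π.eq_zero_of_notMem _ _ _ _ _ _ hε (Γ.self_mem i a) hy)

variable [Fintype I] [∀ i, DecidableEq (A i)]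

theorem asyncChain_update (ε : ℝ) {a : ∀ i, A i} {i : I} {y : A i} (hy : y ≠ a i) :
    asyncChain Γ π ε a (Function.update a i y) =
      (Fintype.card I : ℝ)⁻¹ * choiceProb Γ π ε a i y := by
  rw [asyncChain, Finset.sum_eq_single i]
  · congr 1
    rw [Finset.sum_eq_single y]
    · simp
    · intro z _ hz
      exact if_neg fun h => hz (Function.update_injective a i h)
    · simp
  · intro j _ hj
    rw [Finset.sum_eq_zero, mul_zero]
    intro z _
    refine if_neg fun h => hy ?_
    have := congrFun h i
    rw [Function.update_of_ne hj.symm, Function.update_self] at this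
    exact this.symm
  · simp

variable {Γ π} in
theorem exists_update_of_asyncChain_pos {ε : ℝ} {a b : ∀ i, A i}
    (h : 0 < asyncChain Γ π ε a b) (hab : a ≠ b) :
    ∃ (i : I) (y : A i), y ≠ a i ∧ b = Function.update a i y := by
  by_contra! hne
  refine h.ne' (Finset.sum_eq_zero fun i _ => ?_)
  rw [Finset.sum_eq_zero, mul_zero]
  intro y _
  refine if_neg fun heq => ?_
  by_cases hy : y = a i
  · rw [hy, Function.update_eq_self] at heq
    exact hab heq
  · exact hne i y hy heq.symm

variable [Nonempty I]

theorem isResistance_asyncChain_update_iff {a : ∀ i, A i} {i : I} {y : A i} (hy : y ≠ a i)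
    {r : ℝ} : IsResistance (asyncChain Γ π) a (Function.update a i y) r ↔
      HasOrder (fun ε => choiceProb Γ π ε a i y) r := by
  have hcard : 0 < (Fintype.card I : ℝ) := by exact_mod_cast Fintype.card_pos
  constructor
  · intro h
    have := h.hasOrder.mul_tendsto hcard tendsto_const_nhds
    simp only [asyncChain_update Γ π _ hy] at this
    convert this using 2 with ε
    field_simp
  · intro h
    have := h.mul_tendsto (inv_pos.2 hcard) tendsto_const_nhds
    refine HasOrder.isResistance ?_
    simp only [asyncChain_update Γ π _ hy]
    convert this using 2 with ε
    ring

/-- Proper switches are read off off-diagonal entries. The diagonal entry mixes all agents, so the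
probability of keeping `a i` is obtained as the complement. -/
theorem tendsto_choiceProb
    (h : ∀ a b, Tendsto (fun ε : ℝ => asyncChain Γ π ε a b) (𝓝[>] 0) (𝓝 (asyncChain Γ π 0 a b)))
    (a : ∀ i, A i) (i : I) (y : A i) :
    Tendsto (fun ε : ℝ => choiceProb Γ π ε a i y) (𝓝[>] 0) (𝓝 (choiceProb Γ π 0 a i y)) := by
  have hcard : (Fintype.card I : ℝ) ≠ 0 := by exact_mod_cast Fintype.card_ne_zero
  have hne : ∀ z, z ≠ a i →
      Tendsto (fun ε : ℝ => choiceProb Γ π ε a i z) (𝓝[>] 0) (𝓝 (choiceProb Γ π 0 a i z)) := by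
    intro z hz
    have := (h a (Function.update a i z)).const_mul (Fintype.card I : ℝ)
    simpa only [asyncChain_update Γ π _ hz, mul_inv_cancel_left₀ hcard] using this
  by_cases hy : y = a i
  · have hcompl : ∀ ε : ℝ, 0 ≤ ε →
        choiceProb Γ π ε a i y = 1 - ∑ z ∈ Finset.univ.erase y, choiceProb Γ π ε a i z := by
      intro ε hε
      rw [← sum_choiceProb Γ π hε a i, ← Finset.add_sum_erase _ _ (Finset.mem_univ y)]
      ring
    rw [hcompl 0 le_rfl]
    refine (tendsto_const_nhds.sub (tendsto_finsetSum _ fun z hz => hne z ?_)).congr' ?_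
    · rw [← hy]
      exact Finset.ne_of_mem_erase hz
    · filter_upwards [eventually_pos_nhdsGT] with ε hε
      rw [hcompl ε hε.le]
  · exact hne y hy

end Async

/-! ### The synchronous chain -/

section Draws

variable {I : Type*} [Fintype I]

instance isProbabilityMeasure_uniformDraws : IsProbabilityMeasure (uniformDraws I) := by
  have : IsProbabilityMeasure (volume.restrict (Set.Ioo (0 : ℝ) 1)) := ⟨by simp⟩
  unfold uniformDraws
  infer_instance

theorem uniformDraws_pi_pos {s : I → Set ℝ}
    (h : ∀ i, 0 < volume.restrict (Set.Ioo (0 : ℝ) 1) (s i)) :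
    0 < uniformDraws I (Set.univ.pi s) := by
  have : IsProbabilityMeasure (volume.restrict (Set.Ioo (0 : ℝ) 1)) := ⟨by simp⟩
  rw [uniformDraws, Measure.pi_pi]
  exact pos_iff_ne_zero.2 (Finset.prod_ne_zero_iff.2 fun i _ => (h i).ne')

variable {A : I → Type*}

theorem measurableSet_syncStep_eq (Ic : I → (∀ i, A i) → Set I) (κ : ℝ) (a abar a' : ∀ i, A i) :
    MeasurableSet {ω : (I → ℝ) × (I → ℝ) | syncStep Ic κ a abar ω.1 ω.2 = a'} := by
  classical
  have hprio : ∀ i, Measurable fun ω : (I → ℝ) × (I → ℝ) => priority κ a abar ω.1 ω.2 i := by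
    intro i
    unfold priority
    refine Measurable.ite ?_ measurable_const (by fun_prop)
    exact (MeasurableSet.const _).union
      (measurableSet_le (by fun_prop : Measurable fun ω : (I → ℝ) × (I → ℝ) => ω.1 i)
        measurable_const)
  have hset : {ω : (I → ℝ) × (I → ℝ) | syncStep Ic κ a abar ω.1 ω.2 = a'} =
      ⋂ i, {ω | syncStep Ic κ a abar ω.1 ω.2 i = a' i} := by
    ext ω
    simp [funext_iff]
  rw [hset]
  refine MeasurableSet.iInter fun i => ?_
  let : MeasurableSpace (A i) := ⊤
  have hmeas : Measurable fun ω : (I → ℝ) × (I → ℝ) => syncStep Ic κ a abar ω.1 ω.2 i := by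
    unfold syncStep
    refine Measurable.ite ?_ measurable_const measurable_const
    refine (measurableSet_eq_fun (hprio i) measurable_const).union ?_
    have : MeasurableSet {ω : (I → ℝ) × (I → ℝ) | ∃ j, j ≠ i ∧ j ∈ Ic i a ∧
        priority κ a abar ω.1 ω.2 i ≤ priority κ a abar ω.1 ω.2 j} := by
      rw [Set.ofPred_exists]
      exact MeasurableSet.iUnion fun j => (MeasurableSet.const _).inter
        ((MeasurableSet.const _).inter (measurableSet_le (hprio i) (hprio j)))
    exact this
  exact hmeas (MeasurableSpace.measurableSet_top (s := {a' i}))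

end Draws

/-! ### Moves that one synchronous round can make -/

section Sync

variable {I : Type*} {A : I → Type*}

/-- No two distinct agents who switch from `a` to `b` are coupled at `a`. -/
def IsUncoupledMove (Ic : I → (∀ i, A i) → Set I) (a b : ∀ i, A i) : Prop :=
  ∀ i j, b i ≠ a i → b j ≠ a j → j ∈ Ic i a → j = i

theorem isUncoupledMove_self (Ic : I → (∀ i, A i) → Set I) (a : ∀ i, A i) :
    IsUncoupledMove Ic a a := fun _ _ h => absurd rfl h

theorem isUncoupledMove_update [DecidableEq I] (Ic : I → (∀ i, A i) → Set I) (a : ∀ i, A i)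
    (i : I) (y : A i) : IsUncoupledMove Ic a (Function.update a i y) := by
  have h : ∀ j, Function.update a i y j ≠ a j → j = i := fun j hj => by
    by_contra hji
    exact hj (Function.update_of_ne hji _ _)
  exact fun j k hj hk _ => (h k hk).trans (h j hj).symm

variable {Ic : I → (∀ i, A i) → Set I} {κ : ℝ} {a abar b : ∀ i, A i} {k u : I → ℝ}

theorem syncStep_eq_of_ne (h : syncStep Ic κ a abar k u = b) {i : I} (hi : b i ≠ a i) :
    abar i = b i ∧ ∀ j, j ≠ i → j ∈ Ic i a →
      priority κ a abar k u j < priority κ a abar k u i := by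
  have hb := congrFun h i
  rw [syncStep] at hb
  split_ifs at hb with hc
  · exact absurd hb.symm hi
  · push Not at hc
    exact ⟨hb, hc.2⟩

theorem isUncoupledMove_of_syncStep_eq (hsymm : ∀ i j a, i ∈ Ic j a ↔ j ∈ Ic i a)
    (h : syncStep Ic κ a abar k u = b) : IsUncoupledMove Ic a b := by
  intro i j hi hj hij
  by_contra hne
  exact lt_asymm ((syncStep_eq_of_ne h hi).2 j hne hij)
    ((syncStep_eq_of_ne h hj).2 i (Ne.symm hne) ((hsymm i j a).2 hij))

theorem syncStep_eq_of_isUncoupledMove (hmove : IsUncoupledMove Ic a b)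
    (habar : ∀ i, b i ≠ a i → abar i = b i) (hstay : ∀ i, b i = a i → k i ≤ κ)
    (hgo : ∀ i, b i ≠ a i → κ < k i) (hu : ∀ i, 0 < u i) :
    syncStep Ic κ a abar k u = b := by
  have h0 : ∀ i, b i = a i → priority κ a abar k u i = 0 := fun i hi =>
    if_pos (Or.inr (hstay i hi))
  have h1 : ∀ i, b i ≠ a i → priority κ a abar k u i = u i := fun i hi =>
    if_neg (by
      rw [habar i hi]
      exact not_or.2 ⟨hi, (hgo i hi).not_ge⟩)
  ext i
  rw [syncStep]
  by_cases hi : b i = a i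
  · rw [if_pos (Or.inl (h0 i hi)), hi]
  · rw [if_neg, habar i hi]
    rw [h1 i hi]
    rintro (h | ⟨j, hji, hj, hle⟩)
    · exact (hu i).ne' h
    · by_cases hbj : b j = a j
      · rw [h0 j hbj] at hle
        exact (hu i).not_ge hle
      · exact hji (hmove i j hi hbj hj)

/-- The witness is the event that exactly the agents who must switch overcome inertia and all draws
`u` are positive. It does not involve `abar`, hence a bound uniform in the intentions of the agents
who stay. -/
theorem exists_le_measure_syncStep_eq [Fintype I] (hκ0 : 0 < κ) (hκ1 : κ < 1)
    (hmove : IsUncoupledMove Ic a b) :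
    ∃ c, 0 < c ∧ ∀ abar : ∀ i, A i, (∀ i, b i ≠ a i → abar i = b i) →
      c ≤ ((uniformDraws I).prod (uniformDraws I)).real
        {ω | syncStep Ic κ a abar ω.1 ω.2 = b} := by
  classical
  refine ⟨((uniformDraws I).prod (uniformDraws I)).real
    ((Set.univ.pi fun i => if b i = a i then Set.Iic κ else Set.Ioi κ) ×ˢ
      (Set.univ.pi fun _ => Set.Ioi 0)), ?_, fun abar habar => ?_⟩
  · rw [measureReal_def, ENNReal.toReal_pos_iff, Measure.prod_prod]
    refine ⟨ENNReal.mul_pos (uniformDraws_pi_pos fun i => ?_).ne'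
      (uniformDraws_pi_pos fun i => ?_).ne', ?_⟩
    · split_ifs
      · rw [Measure.restrict_apply measurableSet_Iic]
        refine lt_of_lt_of_le ?_ (measure_mono (s := Set.Ioo 0 κ) fun x hx =>
          ⟨hx.2.le, hx.1, hx.2.trans hκ1⟩)
        simpa using hκ0
      · rw [Measure.restrict_apply measurableSet_Ioi]
        refine lt_of_lt_of_le ?_ (measure_mono (s := Set.Ioo κ 1) fun x hx =>
          ⟨hx.1, hκ0.trans hx.1, hx.2⟩)
        simpa using hκ1
    · rw [Measure.restrict_apply measurableSet_Ioi]
      refine lt_of_lt_of_le ?_ (measure_mono (s := Set.Ioo 0 1) fun x hx => ⟨hx.1, hx⟩)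
      simp
    · rw [← Measure.prod_prod]
      exact measure_lt_top _ _
  · refine measureReal_mono ?_
    rintro ⟨k, u⟩ ⟨hk, hu⟩
    simp only [Set.mem_pi, Set.mem_univ, true_implies] at hk hu
    refine syncStep_eq_of_isUncoupledMove hmove habar (fun i hi => ?_) (fun i hi => ?_) hu
    · simpa [hi] using hk i
    · simpa [hi] using hk i

end Sync

/-- Agents who are not coupled do not affect each other's choices. -/
theorem choiceProb_eq_of_isUncoupledMove {I : Type*} {A : I → Type*} [DecidableEq I]
    [∀ i, Fintype (A i)] {Γ : ConstrainedGame I A} {π : UpdatePolicy I A}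
    {Ic : I → (∀ i, A i) → Set I} (hIc : IsValidCoupling Γ Ic) {a b x : ∀ i, A i}
    (hmove : IsUncoupledMove Ic a b) (hC : ∀ i, b i ≠ a i → b i ∈ Γ.C i a)
    (hx : ∀ j, x j = a j ∨ x j = b j) {i : I} (hi : b i ≠ x i) {ε : ℝ} (hε : 0 ≤ ε) :
    choiceProb Γ π ε x i = choiceProb Γ π ε a i := by
  have hxi : x i = a i := (hx i).resolve_right hi.symm
  have hbi : b i ≠ a i := hxi ▸ hi
  -- Away from `i`, `x` differs from `a` only at agents who have already switched. These are
  -- uncoupled from `i`, and their new actions are feasible at `a`.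
  have hunc : ∀ z ∈ Γ.C i a, Γ.U i (Function.update x i z) = Γ.U i (Function.update a i z) ∧
      Γ.C i (Function.update x i z) = Γ.C i (Function.update a i z) := by
    intro z hz
    have := hIc.uncoupled i a (Function.update x i z) (by simpa using hz) (fun j hj => ?_)
      (fun j hji hj => ?_)
    · simpa using this
    · have hji : j ≠ i := fun h => hj (h ▸ hIc.self_mem i a)
      rw [Function.update_of_ne hji]
      by_cases hbj : b j = a j
      · rcases hx j with h | h
        · rw [h]; exact Γ.self_mem j a
        · rw [h, hbj]; exact Γ.self_mem j a
      · rcases hx j with h | h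
        · rw [h]; exact Γ.self_mem j a
        · rw [h]; exact hC j hbj
    · rw [Function.update_of_ne hji]
      by_contra hne
      have hbj : b j ≠ a j := (hx j).resolve_left hne ▸ hne
      exact hji (hmove i j hbi hbj (not_not.1 hj))
  -- Taking the deviation `a i` turns both updated profiles back into `x` and `a`.
  have hCx : Γ.C i x = Γ.C i a := by
    have := (hunc (a i) (Γ.self_mem i a)).2
    rwa [Function.update_eq_self, ← hxi, Function.update_eq_self] at this
  ext y
  rw [choiceProb, choiceProb, hxi, hCx]
  exact congrFun (π.congr_utility ε i _ _ _ _ hε (Γ.self_mem i a) fun z hz => (hunc z hz).1) y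

/-! ### Factorization and positivity of the synchronous transition probabilities -/

section SyncChain

variable {I : Type*} {A : I → Type*} [Fintype I] [DecidableEq I] [∀ i, Fintype (A i)]
  [∀ i, DecidableEq (A i)] (Γ : ConstrainedGame I A) (π : UpdatePolicy I A)
  (Ic : I → (∀ i, A i) → Set I) (κ : ℝ)

theorem syncChain_mem_rowStochastic {ε : ℝ} (hε : 0 ≤ ε) :
    syncChain Γ π Ic κ ε ∈ Matrix.rowStochastic ℝ (∀ i, A i) := by
  rw [Matrix.mem_rowStochastic_iff_sum]
  constructor
  · intro a b
    exact Finset.sum_nonneg fun abar _ => mul_nonneg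
      (Finset.prod_nonneg fun i _ => choiceProb_nonneg Γ π hε a i _) measureReal_nonneg
  · intro a
    have hone : ∀ abar : ∀ i, A i, ∑ b, ((uniformDraws I).prod (uniformDraws I)).real
        {ω | syncStep Ic κ a abar ω.1 ω.2 = b} = 1 := by
      intro abar
      have := sum_measureReal_preimage_singleton
        (μ := (uniformDraws I).prod (uniformDraws I))
        (f := fun ω : (I → ℝ) × (I → ℝ) => syncStep Ic κ a abar ω.1 ω.2) Finset.univ
        (fun b _ => measurableSet_syncStep_eq Ic κ a abar b)
      rw [Finset.coe_univ, Set.preimage_univ, probReal_univ] at this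
      exact this
    simp only [syncChain]
    rw [Finset.sum_comm]
    simp only [← Finset.mul_sum, hone, mul_one]
    rw [← Fintype.prod_sum]
    exact Finset.prod_eq_one fun i _ => sum_choiceProb Γ π hε a i

/-- The probability of the transition from `a` to `b` of the synchronous chain, given that the
agents who have to switch intend to do so. -/
noncomputable def syncFactor (a b : ∀ i, A i) (ε : ℝ) : ℝ :=
  ∑ abar : ∀ i, A i,
    (∏ i, if b i ≠ a i then if abar i = b i then 1 else 0 else choiceProb Γ π ε a i (abar i)) *
      ((uniformDraws I).prod (uniformDraws I)).real {ω | syncStep Ic κ a abar ω.1 ω.2 = b}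

/-- Only intended profiles that agree with `b` at every switching agent can lead to `b`, so the
choice probabilities of these agents factor out of the sum. -/
theorem syncChain_eq_prod_mul_syncFactor (ε : ℝ) (a b : ∀ i, A i) :
    syncChain Γ π Ic κ ε a b =
      (∏ i with b i ≠ a i, choiceProb Γ π ε a i (b i)) * syncFactor Γ π Ic κ a b ε := by
  rw [syncChain, syncFactor, Finset.mul_sum]
  refine Finset.sum_congr rfl fun abar _ => ?_
  rw [← mul_assoc]
  by_cases habar : ∀ i, b i ≠ a i → abar i = b i
  · congr 1
    rw [Finset.prod_filter, ← Finset.prod_mul_distrib]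
    refine Finset.prod_congr rfl fun i _ => ?_
    by_cases hi : b i = a i
    · simp [hi]
    · simp [hi, habar i hi]
  · have : {ω : (I → ℝ) × (I → ℝ) | syncStep Ic κ a abar ω.1 ω.2 = b} = ∅ := by
      ext ω
      exact iff_of_false (fun h => habar fun i hi => (syncStep_eq_of_ne h hi).1) id
    simp [this]

theorem tendsto_syncFactor
    (h : ∀ a i y, Tendsto (fun ε : ℝ => choiceProb Γ π ε a i y) (𝓝[>] 0)
      (𝓝 (choiceProb Γ π 0 a i y))) (a b : ∀ i, A i) :
    Tendsto (syncFactor Γ π Ic κ a b) (𝓝[>] 0) (𝓝 (syncFactor Γ π Ic κ a b 0)) := by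
  refine tendsto_finsetSum _ fun abar _ => Tendsto.mul_const _ (tendsto_finsetProd _ fun i _ => ?_)
  split_ifs
  · exact tendsto_const_nhds
  · exact tendsto_const_nhds
  · exact h a i _

variable {Ic κ}

/-- The factor averages the round's success probability over a product distribution of intentions,
concentrated on profiles for which the uniform lower bound holds. This includes `ε = 0`, so the
limit of the factor is positive. -/
theorem syncFactor_pos (hκ0 : 0 < κ) (hκ1 : κ < 1) {a b : ∀ i, A i}
    (hmove : IsUncoupledMove Ic a b) {ε : ℝ} (hε : 0 ≤ ε) : 0 < syncFactor Γ π Ic κ a b ε := by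
  obtain ⟨c, hc, hle⟩ := exists_le_measure_syncStep_eq hκ0 hκ1 hmove
  let q : ∀ i, A i → ℝ := fun i y =>
    if b i ≠ a i then if y = b i then 1 else 0 else choiceProb Γ π ε a i y
  have hq : ∀ i y, 0 ≤ q i y := by
    intro i y
    simp only [q]
    split_ifs
    · exact zero_le_one
    · exact le_rfl
    · exact choiceProb_nonneg Γ π hε a i y
  have hsum : ∑ abar : ∀ i, A i, ∏ i, q i (abar i) = 1 := by
    rw [← Fintype.prod_sum]
    refine Finset.prod_eq_one fun i _ => ?_
    by_cases hi : b i = a i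
    · simpa [q, hi] using sum_choiceProb Γ π hε a i
    · simp [q, hi]
  have hbound : c ≤ syncFactor Γ π Ic κ a b ε := by
    calc c = ∑ abar : ∀ i, A i, (∏ i, q i (abar i)) * c := by rw [← Finset.sum_mul, hsum, one_mul]
      _ ≤ syncFactor Γ π Ic κ a b ε := Finset.sum_le_sum fun abar _ => ?_
    by_cases habar : ∀ i, b i ≠ a i → abar i = b i
    · exact mul_le_mul_of_nonneg_left (hle abar habar) (Finset.prod_nonneg fun i _ => hq i _)
    · push Not at habar
      obtain ⟨i, hi, hne⟩ := habar
      have : ∏ i, q i (abar i) = 0 :=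
        Finset.prod_eq_zero (Finset.mem_univ i) (by simp [q, hi, hne])
      change _ ≤ (∏ i, q i (abar i)) * _
      rw [this, zero_mul, zero_mul]
  exact hc.trans_le hbound

variable {Γ π}

theorem syncChain_pos_iff (hIc : IsValidCoupling Γ Ic) (hκ0 : 0 < κ) (hκ1 : κ < 1)
    {a b : ∀ i, A i} {ε : ℝ} (hε : 0 ≤ ε) :
    0 < syncChain Γ π Ic κ ε a b ↔
      IsUncoupledMove Ic a b ∧ ∀ i, b i ≠ a i → 0 < choiceProb Γ π ε a i (b i) := by
  constructor
  · intro h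
    have hmove : IsUncoupledMove Ic a b := by
      by_contra hmove
      refine h.ne' (Finset.sum_eq_zero fun abar _ => ?_)
      have : {ω : (I → ℝ) × (I → ℝ) | syncStep Ic κ a abar ω.1 ω.2 = b} = ∅ := by
        ext ω
        exact iff_of_false (fun h => hmove (isUncoupledMove_of_syncStep_eq hIc.symm h)) id
      simp [this]
    refine ⟨hmove, fun i hi => (choiceProb_nonneg Γ π hε a i _).lt_of_ne' fun h0 => ?_⟩
    rw [syncChain_eq_prod_mul_syncFactor, Finset.prod_eq_zero (i := i) (by simpa using hi) h0,
      zero_mul] at h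
    exact h.false
  · rintro ⟨hmove, hpos⟩
    rw [syncChain_eq_prod_mul_syncFactor]
    exact mul_pos (Finset.prod_pos fun i hi => hpos i (by simpa using hi))
      (syncFactor_pos Γ π hκ0 hκ1 hmove hε)

end SyncChain

/-! ### Comparison of the two chains -/

section Reachability

variable {S : Type*} [Fintype S] [DecidableEq S]

theorem Reachable.refl (M : Matrix S S ℝ) (a : S) : Reachable M a a := ⟨0, by simp⟩

theorem Reachable.trans {M : Matrix S S ℝ} (hM : ∀ i j, 0 ≤ M i j) {a b c : S}
    (h1 : Reachable M a b) (h2 : Reachable M b c) : Reachable M a c := by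
  obtain ⟨s, hs⟩ := h1
  obtain ⟨t, ht⟩ := h2
  exact ⟨s + t, Matrix.pow_add_apply_pos hM hs ht⟩

theorem Reachable.of_apply_pos {M : Matrix S S ℝ} {a b : S} (h : 0 < M a b) : Reachable M a b :=
  ⟨1, by simpa using h⟩

theorem Matrix.pow_apply_pos_of_imp {M N : Matrix S S ℝ} (hM : ∀ i j, 0 ≤ M i j)
    (hN : ∀ i j, 0 ≤ N i j) (h : ∀ a b, 0 < M a b → 0 < N a b) (t : ℕ) {a b : S}
    (hab : 0 < (M ^ t) a b) : 0 < (N ^ t) a b := by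
  induction t generalizing a with
  | zero => simpa using hab
  | succ t ih =>
    rw [Matrix.pow_succ_apply_pos_iff hM] at hab
    rw [Matrix.pow_succ_apply_pos_iff hN]
    obtain ⟨c, h1, h2⟩ := hab
    exact ⟨c, h a c h1, ih h2⟩

theorem Reachable.of_imp {M N : Matrix S S ℝ} (hM : ∀ i j, 0 ≤ M i j) (hN : ∀ i j, 0 ≤ N i j)
    (h : ∀ a b, 0 < M a b → Reachable N a b) {a b : S} (hab : Reachable M a b) :
    Reachable N a b := by
  obtain ⟨t, ht⟩ := hab
  induction t generalizing a with
  | zero =>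
    by_cases heq : a = b
    · exact heq ▸ .refl N a
    · simp [heq] at ht
  | succ t ih =>
    rw [Matrix.pow_succ_apply_pos_iff hM] at ht
    obtain ⟨c, h1, h2⟩ := ht
    exact (h a c h1).trans hN (ih h2)

theorem CostPath.reachable {M : Matrix S S ℝ} (hM : ∀ i j, 0 ≤ M i j) {n : ℕ} {a b : S} {c : ℝ}
    (h : CostPath (fun x y _ => 0 < M x y) n a b c) : Reachable M a b := by
  induction h with
  | nil a => exact .refl M a
  | cons _ h _ ih => exact (Reachable.of_apply_pos h).trans hM ih

end Reachability

/-! ### Transfer of regularity, resistances and reachability -/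

section Comparison

variable {I : Type*} [Fintype I] [DecidableEq I] [Nonempty I] {A : I → Type*}
  [∀ i, Fintype (A i)] [∀ i, DecidableEq (A i)] {Γ : ConstrainedGame I A} {π : UpdatePolicy I A}
  {Ic : I → (∀ i, A i) → Set I} {κ : ℝ}

theorem asyncChain_update_pos_iff {ε : ℝ} {a : ∀ i, A i} {i : I} {y : A i} (hy : y ≠ a i) :
    0 < asyncChain Γ π ε a (Function.update a i y) ↔ 0 < choiceProb Γ π ε a i y := by
  have hcard : 0 < (Fintype.card I : ℝ) := by exact_mod_cast Fintype.card_pos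
  rw [asyncChain_update Γ π ε hy]
  exact mul_pos_iff_of_pos_left (inv_pos.2 hcard)

theorem syncChain_pos_of_asyncChain_pos (hIc : IsValidCoupling Γ Ic) (hκ0 : 0 < κ) (hκ1 : κ < 1)
    {ε : ℝ} (hε : 0 ≤ ε) {a b : ∀ i, A i} (h : 0 < asyncChain Γ π ε a b) :
    0 < syncChain Γ π Ic κ ε a b := by
  rw [syncChain_pos_iff hIc hκ0 hκ1 hε]
  by_cases hab : a = b
  · subst hab
    exact ⟨isUncoupledMove_self Ic a, fun i hi => absurd rfl hi⟩
  · obtain ⟨i, y, hy, rfl⟩ := exists_update_of_asyncChain_pos h hab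
    refine ⟨isUncoupledMove_update Ic a i y, fun j hj => ?_⟩
    by_cases hji : j = i
    · subst hji
      simpa using (asyncChain_update_pos_iff hy).1 h
    · exact absurd (Function.update_of_ne hji _ _) hj

theorem reachable_asyncChain_of_syncChain_pos (hIc : IsValidCoupling Γ Ic) (hκ0 : 0 < κ)
    (hκ1 : κ < 1) {ε : ℝ} (hε : 0 ≤ ε) (hnn : ∀ a b, 0 ≤ asyncChain Γ π ε a b)
    {a b : ∀ i, A i} (h : 0 < syncChain Γ π Ic κ ε a b) :
    Reachable (asyncChain Γ π ε) a b := by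
  obtain ⟨hmove, hpos⟩ := (syncChain_pos_iff hIc hκ0 hκ1 hε).1 h
  obtain ⟨n, hn⟩ := exists_costPath_of_interpolation (a := a) (b := b) (r := fun _ => 0)
    (R := fun x y _ => 0 < asyncChain Γ π ε x y) fun x i hx hi => by
      rw [asyncChain_update_pos_iff hi, choiceProb_eq_of_isUncoupledMove hIc hmove
        (fun j hj => mem_constraint_of_choiceProb_pos hε (hpos j hj)) hx hi hε]
      exact hpos i ((hx i).resolve_right hi.symm ▸ hi)
  exact hn.reachable hnn

theorem isResistance_syncChain (hP : IsRegularPerturbedChain (asyncChain Γ π)) (hκ0 : 0 < κ)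
    (hκ1 : κ < 1) {a b : ∀ i, A i} (hmove : IsUncoupledMove Ic a b) {r : I → ℝ}
    (hr : ∀ i, b i ≠ a i → HasOrder (fun ε => choiceProb Γ π ε a i (b i)) (r i)) :
    IsResistance (syncChain Γ π Ic κ) a b (∑ i with b i ≠ a i, r i) := by
  have hprod : HasOrder (fun ε => ∏ i with b i ≠ a i, choiceProb Γ π ε a i (b i))
      (∑ i with b i ≠ a i, r i) := .prod _ fun i hi => hr i (by simpa using hi)
  have := hprod.mul_tendsto (syncFactor_pos Γ π hκ0 hκ1 hmove le_rfl)
    (tendsto_syncFactor Γ π Ic κ (tendsto_choiceProb Γ π hP.tendsto_zero) a b)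
  simp only [← syncChain_eq_prod_mul_syncFactor] at this
  exact this.isResistance

theorem exists_hasOrder_choiceProb (hP : IsRegularPerturbedChain (asyncChain Γ π))
    (hIc : IsValidCoupling Γ Ic) (hκ0 : 0 < κ) (hκ1 : κ < 1) {a b : ∀ i, A i} {ε : ℝ}
    (hε : 0 < ε) (h : 0 < syncChain Γ π Ic κ ε a b) :
    ∃ r : I → ℝ, ∀ i, b i ≠ a i → HasOrder (fun ε => choiceProb Γ π ε a i (b i)) (r i) := by
  have hpos := ((syncChain_pos_iff hIc hκ0 hκ1 hε.le).1 h).2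
  have hr : ∀ i, b i ≠ a i → ∃ r, HasOrder (fun ε => choiceProb Γ π ε a i (b i)) r := by
    intro i hi
    obtain ⟨r, hr⟩ := hP.exists_resistance a (Function.update a i (b i)) ε hε
      ((asyncChain_update_pos_iff hi).2 (hpos i hi))
    exact ⟨r, (isResistance_asyncChain_update_iff Γ π hi).1 hr⟩
  choose! r hr using hr
  exact ⟨r, hr⟩

theorem isRegularPerturbedChain_syncChain (hP : IsRegularPerturbedChain (asyncChain Γ π))
    (hIc : IsValidCoupling Γ Ic) (hκ0 : 0 < κ) (hκ1 : κ < 1) :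
    IsRegularPerturbedChain (syncChain Γ π Ic κ) := by
  have hst : ∀ ε : ℝ, 0 ≤ ε → syncChain Γ π Ic κ ε ∈ Matrix.rowStochastic ℝ (∀ i, A i) :=
    fun ε hε => syncChain_mem_rowStochastic Γ π Ic κ hε
  refine ⟨hst, fun ε hε => ?_, fun ε hε a d hd => ?_, fun a b => ?_, fun a b ε hε h => ?_⟩
  · have hnn : ∀ a b, 0 ≤ syncChain Γ π Ic κ ε a b := fun _ _ =>
      Matrix.nonneg_of_mem_rowStochastic (hst ε hε.le)
    have hirr := hP.irreducible ε hε
    rw [Matrix.isIrreducible_iff_exists_pow_pos hnn]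
    intro a b
    obtain ⟨t, ht, hpos⟩ := (Matrix.isIrreducible_iff_exists_pow_pos hirr.nonneg).1 hirr a b
    exact ⟨t, ht, Matrix.pow_apply_pos_of_imp hirr.nonneg hnn
      (fun _ _ => syncChain_pos_of_asyncChain_pos hIc hκ0 hκ1 hε.le) t hpos⟩
  -- Inertia gives every state a self-loop.
  · refine Nat.dvd_one.1 (hd 1 ?_)
    rw [pow_one, syncChain_pos_iff hIc hκ0 hκ1 hε.le]
    exact ⟨isUncoupledMove_self Ic a, fun i hi => absurd rfl hi⟩
  · exact tendsto_finsetSum _ fun abar _ => (tendsto_finsetProd _ fun i _ =>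
      tendsto_choiceProb Γ π hP.tendsto_zero a i (abar i)).mul_const _
  · obtain ⟨r, hr⟩ := exists_hasOrder_choiceProb hP hIc hκ0 hκ1 hε h
    exact ⟨_, isResistance_syncChain hP hκ0 hκ1 ((syncChain_pos_iff hIc hκ0 hκ1 hε.le).1 h).1 hr⟩

theorem isResistance_syncChain_of_asyncChain (hP : IsRegularPerturbedChain (asyncChain Γ π))
    (hκ0 : 0 < κ) (hκ1 : κ < 1) {a b : ∀ i, A i} {r : ℝ} (hab : a ≠ b)
    (h : IsResistance (asyncChain Γ π) a b r) : IsResistance (syncChain Γ π Ic κ) a b r := by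
  obtain ⟨ε, -, hpos⟩ := h.hasOrder.exists_pos
  obtain ⟨i, y, hy, rfl⟩ := exists_update_of_asyncChain_pos hpos hab
  have hi : ∀ j, Function.update a i y j ≠ a j ↔ j = i := by
    intro j
    by_cases hji : j = i
    · subst hji; simpa using hy
    · simp [hji]
  have := isResistance_syncChain (Ic := Ic) hP hκ0 hκ1 (isUncoupledMove_update Ic a i y)
    (r := fun _ => r) (fun j hj => by
      obtain rfl := (hi j).1 hj
      simpa using (isResistance_asyncChain_update_iff Γ π hy).1 h)
  simpa [hi, Finset.filter_eq'] using this

/-- The switches are serialized: along any order, each agent still chooses as it would at `a`, so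
the unilateral resistances are unchanged and add up to `r`. A self-transition becomes the empty path
of cost zero. -/
theorem exists_costPath_of_isResistance_syncChain
    (hP : IsRegularPerturbedChain (asyncChain Γ π)) (hIc : IsValidCoupling Γ Ic) (hκ0 : 0 < κ)
    (hκ1 : κ < 1) {a b : ∀ i, A i} {r : ℝ} (h : IsResistance (syncChain Γ π Ic κ) a b r) :
    ∃ n, CostPath (IsResistance (asyncChain Γ π)) n a b r := by
  obtain ⟨ε, hε, hpos⟩ := h.hasOrder.exists_pos
  obtain ⟨hmove, hchoice⟩ := (syncChain_pos_iff hIc hκ0 hκ1 hε.le).1 hpos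
  obtain ⟨s, hs⟩ := exists_hasOrder_choiceProb hP hIc hκ0 hκ1 hε hpos
  rw [h.hasOrder.unique (isResistance_syncChain hP hκ0 hκ1 hmove hs).hasOrder]
  refine exists_costPath_of_interpolation fun x i hx hi => ?_
  rw [isResistance_asyncChain_update_iff Γ π hi]
  obtain ⟨h0, L, hL, hlim⟩ := hs i ((hx i).resolve_right hi.symm ▸ hi)
  refine ⟨h0, L, hL, hlim.congr' ?_⟩
  filter_upwards [eventually_pos_nhdsGT] with δ hδ
  rw [choiceProb_eq_of_isUncoupledMove hIc hmove
    (fun j hj => mem_constraint_of_choiceProb_pos hε.le (hchoice j hj)) hx hi hδ.le]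

theorem reachable_syncChain_zero_iff (hP : IsRegularPerturbedChain (asyncChain Γ π))
    (hIc : IsValidCoupling Γ Ic) (hκ0 : 0 < κ) (hκ1 : κ < 1) {a b : ∀ i, A i} :
    Reachable (syncChain Γ π Ic κ 0) a b ↔ Reachable (asyncChain Γ π 0) a b := by
  have hasync : ∀ a b, 0 ≤ asyncChain Γ π 0 a b := fun _ _ =>
    Matrix.nonneg_of_mem_rowStochastic (hP.stochastic 0 le_rfl)
  have hsync : ∀ a b, 0 ≤ syncChain Γ π Ic κ 0 a b := fun _ _ =>
    Matrix.nonneg_of_mem_rowStochastic (syncChain_mem_rowStochastic Γ π Ic κ le_rfl)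
  exact ⟨Reachable.of_imp hsync hasync fun _ _ =>
      reachable_asyncChain_of_syncChain_pos hIc hκ0 hκ1 le_rfl hasync,
    Reachable.of_imp hasync hsync fun _ _ h =>
      .of_apply_pos (syncChain_pos_of_asyncChain_pos hIc hκ0 hκ1 le_rfl h)⟩

end Comparison

theorem theorem1 {I : Type*} [Fintype I] [DecidableEq I] [Nonempty I]
    {A : I → Type*} [∀ i, Fintype (A i)] [∀ i, DecidableEq (A i)]
    (Γ : ConstrainedGame I A) (π : UpdatePolicy I A)
    (Ic : I → (∀ i, A i) → Set I) (hIc : IsValidCoupling Γ Ic)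
    (κ : ℝ) (hκ0 : 0 < κ) (hκ1 : κ < 1)
    (hP : IsRegularPerturbedChain (asyncChain Γ π)) :
    IsRegularPerturbedChain (syncChain Γ π Ic κ) ∧
    (∀ a : ∀ i, A i, ∃ γ : ℝ, IsStochasticPotential (asyncChain Γ π) a γ ∧
      IsStochasticPotential (syncChain Γ π Ic κ) a γ) ∧
    (∀ a : ∀ i, A i, IsRecurrentState (asyncChain Γ π 0) a ↔
      IsRecurrentState (syncChain Γ π Ic κ 0) a) ∧
    (∀ a : ∀ i, A i, IsStochasticallyStable (asyncChain Γ π) a ↔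
      IsStochasticallyStable (syncChain Γ π Ic κ) a) := by
  have hP' := isRegularPerturbedChain_syncChain hP hIc hκ0 hκ1
  choose γ hγ using hP.exists_isStochasticPotential
  have hγ' : ∀ a, IsStochasticPotential (syncChain Γ π Ic κ) a (γ a) := fun a =>
    (hγ a).of_costPath (fun _ _ _ => isResistance_syncChain_of_asyncChain hP hκ0 hκ1)
      fun _ _ _ => exists_costPath_of_isResistance_syncChain hP hIc hκ0 hκ1
  refine ⟨hP', fun a => ⟨γ a, hγ a, hγ' a⟩, fun a => ?_, fun a => ?_⟩
  · simp only [IsRecurrentState, reachable_syncChain_zero_iff hP hIc hκ0 hκ1]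
  · rw [hP.isStochasticallyStable_iff hγ, hP'.isStochasticallyStable_iff hγ']
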